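/- **Setting.** Built-in constraints are generated by $c::=d\mid c\wedge c\mid\exists_x c$, with $d$ atomic (equations included), together with the empty conjunction $\mathtt{true}$; their meaning is given by a first-order theory $CT$ that contains the Clark Equality Theory (function symbols are injective with pairwise disjoint ranges, and $x=t$ is false if $x$ occurs in the term $t\ne x$). Free variables in $CT\models\cdots$ are universally quantified; a (conjunction of) constraint(s) inconsistent with $CT$ is called $\mathtt{false}$. $Fv$ denotes free variables. A CHR constraint is an atom $p(\bar t)$; an identified one is $h\#i$ with $i\in\mathbb N$, $chr(h\#i)=h$, $id(h\#i)=i$. For sequences $H,H'$ of CHR constraints, $H=H'$ is the set of equations between corresponding arguments; it is defined only if corresponding atoms have the same predicate symbol. A token is $r@i_1,\dots,i_l$ ($r$ a rule name), and a token store is a set of tokens. An *annotated rule* is $r@H_1\backslash H_2\Leftrightarrow D\,|\,\tilde B;T$ with a name $r$ (names need not be unique), sequences $H_1,H_2$ of CHR constraints, not both empty, a finite multiset $D$ of built-in constraints (guard), a body $\tilde B$ of finitely many built-in and identified CHR constraints, whose identifiers are positive and pairwise distinct, and a token store $T$ all of whose identifiers occur in $\tilde B$. An *annotated program* is a set of annotated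 rules (it need not be finite). $inst(\tilde B,T,n)=(\tilde B',T',m)$ is obtained by adding $n$ to all identifiers; $m$ is the greatest identifier in $(\tilde B',T')$, and $m=n$ if there is none. $clean(\tilde B,T)$ is the set of those $t\in T$ all of whose identifiers occur in $\tilde B$. **Semantics.** A configuration is $\langle\tilde S,C,T\rangle_n$ with $\tilde S$ a finite multiset of built-in constraints and of identified CHR constraints with pairwise distinct identifiers, $C$ a built-in constraint, $T$ a token store, and all identifiers in $\tilde S$ and $T$ at most $n$. It is *failed* if $C$ is $\mathtt{false}$; failed configurations have no transitions. The others have the transitions * Solve': $\langle\{c\}\cup\tilde G,C,T\rangle_n\to\langle\tilde G,C',T\rangle_n$ if $c,C'$ are built-in constraints and $CT\models c\wedge C\leftrightarrow C'$; * Apply': $\langle\tilde H_1\cup\tilde H_2\cup\tilde G,C,T\rangle_n\to\langle\tilde B'\cup\tilde H_1\cup\tilde G,\ (chr(\tilde H_1,\tilde H_2)=(H_1',H_2'))\wedge C,\ T'\rangle_m$ if $r@H_1'\backslash H_2'\Leftrightarrow D|\tilde B;T_r$ is a variant of a rule of the program, renamed apart from all variables used so far in the derivation, $CT\models C\to\exists_x((chr(\tilde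 H_1,\tilde H_2)=(H_1',H_2'))\wedge D)$ with $x=Fv(H_1',H_2')$, $(\tilde B',T_r',m)=inst(\tilde B,T_r,n)$, $r@id(\tilde H_1,\tilde H_2)\notin T$, where $T'=T\cup T_r'\cup\{r@id(\tilde H_1,\tilde H_2)\}$ if $\tilde H_2=\emptyset$, and $T'=T\cup T_r'$ otherwise. A derivation is *normal* if Apply' is used only on configurations that are built-in free, i.e. failed or with no built-in constraint in $\tilde S$. A program is *normal terminating* if there is no infinite normal derivation from any configuration. For a set $V$ of variables, $\sigma_1\simeq'_V\sigma_2$ means that either both are failed, or they are identical up to renaming of variables not in $V$, renaming of identifiers (the counter is disregarded), replacing the token store $T$ by $clean(\tilde S,T)$, and logical equivalence modulo $CT$ of built-in constraints. A program is *normal confluent* if for all $\sigma$ and all normal derivations $\sigma\to^*\sigma_1$, $\sigma\to^*\sigma_2$ there are continuations (not necessarily normal) $\sigma_1\to^*\sigma_1'$, $\sigma_2\to^*\sigma_2'$ with $\sigma_1'\simeq'_{Fv(\sigma)}\sigma_2'$. **Unfolding.** Let $r@H_1\backslash H_2\Leftrightarrow D|\tilde K,\tilde S_1,\tilde S_2,C;T$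 be a rule, $C$ being all the built-in constraints of its body and $\tilde K,\tilde S_1,\tilde S_2$ its identified CHR constraints split in any way, and let $v@H_1'\backslash H_2'\Leftrightarrow D'|\tilde B;T'$ be a variant, renamed apart from $r$, of a rule of the program $P$. Let $\theta$ be a substitution that acts only on $Fv(H_1',H_2')$, with $CT\models(C\wedge D)\to chr(\tilde S_1,\tilde S_2)=(H_1',H_2')\theta$, and suppose $v@id(\tilde S_1,\tilde S_2)\notin T$. Let $m$ be the greatest identifier in the rule $r$ ($0$ if none), $(\tilde B_1,T_1,m_1)=inst(\tilde B,T',m)$, and $D''$ the multiset of those $c$ in $D'$ with $CT\not\models(C\wedge D)\to c\theta$. If $D\wedge D''\theta$ is satisfiable, then $$r@H_1\backslash H_2\Leftrightarrow D,D''\theta\;|\;\tilde K,\tilde S_1,\tilde B_1,C,\ chr(\tilde S_1,\tilde S_2)=(H_1',H_2');\ T''$$ is an unfolding of $r$ with $v$, where $T''=clean((\tilde K,\tilde S_1),T)\cup T_1\cup\{v@id(\tilde S_1)\}$ if $H_2'=\emptyset$, and $T''=clean((\tilde K,\tilde S_1),T)\cup T_1$ otherwise. $Unf_P(r)$ is the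 set of all unfoldings of $r$ with rules of $P$. A rule $r\in P$ with guard $D$ *can be weakly safely replaced* in $P$ if some rule in $Unf_P(r)$ has a guard $\hat D$ with $CT\models D\leftrightarrow\hat D$. **Proposition.** Let $P$ be an annotated program and let $r\in P$ be a rule that can be weakly safely replaced in $P$. Let $P'=(P\setminus\{r\})\cup Unf_P(r)$. If $P$ is normal terminating and normal confluent, then $P'$ is normal terminating and normal confluent too. -/

import Mathlib

universe u v w z

namespace CHR

/-! ### Built-in constraints -/

/-- Variables. -/
abbrev Var : Type := ℕ

/-- Built-in constraints: `c ::= d | c ∧ c | ∃ₓ c`, with `d` atomic (equations included), together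
with the empty conjunction `true`. -/
inductive IsBuiltIn {L : FirstOrder.Language.{u, v}} : ∀ {n : ℕ}, L.BoundedFormula Var n → Prop
  | top {n : ℕ} : IsBuiltIn (⊤ : L.BoundedFormula Var n)
  | atomic {n : ℕ} {φ : L.BoundedFormula Var n} (h : φ.IsAtomic) : IsBuiltIn φ
  | and {n : ℕ} {φ ψ : L.BoundedFormula Var n} (h₁ : IsBuiltIn φ) (h₂ : IsBuiltIn ψ) :
      IsBuiltIn (φ ⊓ ψ)
  | ex {n : ℕ} {φ : L.BoundedFormula Var (n + 1)} (h : IsBuiltIn φ) : IsBuiltIn φ.ex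

theorem IsBuiltIn.subst {L : FirstOrder.Language.{u, v}} {n : ℕ} {φ : L.BoundedFormula Var n}
    (h : IsBuiltIn φ) (f : Var → L.Term Var) : IsBuiltIn (φ.subst f) := by
  induction h with
  | top => exact IsBuiltIn.top
  | atomic h =>
    cases h with
    | equal t₁ t₂ => exact IsBuiltIn.atomic (FirstOrder.Language.BoundedFormula.IsAtomic.equal _ _)
    | rel R ts => exact IsBuiltIn.atomic (FirstOrder.Language.BoundedFormula.IsAtomic.rel _ _)
  | and _ _ ih₁ ih₂ => exact IsBuiltIn.and ih₁ ih₂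
  | ex _ ih => exact IsBuiltIn.ex ih

/-- The type of built-in constraints over the language `L`. -/
def BuiltIn (L : FirstOrder.Language.{u, v}) : Type (max u v) := {φ : L.Formula Var // IsBuiltIn φ}

namespace BuiltIn

variable {L : FirstOrder.Language.{u, v}}

/-- The empty conjunction. -/
def tt : BuiltIn L := ⟨⊤, IsBuiltIn.top⟩

/-- Conjunction. -/
def and (c d : BuiltIn L) : BuiltIn L := ⟨c.1 ⊓ d.1, IsBuiltIn.and c.2 d.2⟩

/-- The equation `s = t`. -/
def eq (s t : L.Term Var) : BuiltIn L :=
  ⟨s.equal t, IsBuiltIn.atomic (FirstOrder.Language.BoundedFormula.IsAtomic.equal _ _)⟩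

/-- (Capture-avoiding) application of a substitution to the free variables. -/
def subst (θ : Var → L.Term Var) (c : BuiltIn L) : BuiltIn L :=
  ⟨FirstOrder.Language.BoundedFormula.subst c.1 θ, c.2.subst θ⟩

/-- Free variables. -/
def fv (c : BuiltIn L) : Set Var := ↑(FirstOrder.Language.BoundedFormula.freeVarFinset c.1)

/-- Truth in a structure under an assignment. -/
def Holds {M : Type w} [L.Structure M] (c : BuiltIn L) (a : Var → M) : Prop :=
  FirstOrder.Language.Formula.Realize c.1 a

end BuiltIn

/-! ### Entailment in the constraint theory `CT`

Multisets of built-in constraints are read as conjunctions; free variables are read as universally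
quantified. -/

section Entailment

variable {L : FirstOrder.Language.{u, v}}

/-- `CT ⊨ Γ → Δ`. -/
def Entails (CT : L.Theory) (Γ Δ : Multiset (BuiltIn L)) : Prop :=
  ∀ (M : FirstOrder.Language.Theory.ModelType.{u, v, max u v} CT) (a : Var → M),
    (∀ c ∈ Γ, c.Holds a) → ∀ d ∈ Δ, d.Holds a

/-- `CT ⊨ Γ → ∃ₓ Δ`, where `x` is the set `X` of variables. -/
def EntailsEx (CT : L.Theory) (Γ : Multiset (BuiltIn L)) (X : Set Var)
    (Δ : Multiset (BuiltIn L)) : Prop :=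
  ∀ (M : FirstOrder.Language.Theory.ModelType.{u, v, max u v} CT) (a : Var → M),
    (∀ c ∈ Γ, c.Holds a) →
      ∃ b : Var → M, (∀ y, y ∉ X → b y = a y) ∧ ∀ d ∈ Δ, d.Holds b

/-- `CT ⊨ Γ ↔ Δ`. -/
def Equivalent (CT : L.Theory) (Γ Δ : Multiset (BuiltIn L)) : Prop :=
  Entails CT Γ Δ ∧ Entails CT Δ Γ

/-- `Γ` is satisfiable (consistent with `CT`). -/
def Satisfiable (CT : L.Theory) (Γ : Multiset (BuiltIn L)) : Prop :=
  ∃ (M : FirstOrder.Language.Theory.ModelType.{u, v, max u v} CT) (a : Var → M), ∀ c ∈ Γ, c.Holds a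

/-- `CT` contains the Clark Equality Theory: function symbols are injective and have pairwise
disjoint ranges, and `x = t` is false whenever `t` is a term other than `x` in which `x` occurs. -/
structure ClarkEquality (CT : L.Theory) : Prop where
  injective : ∀ (M : FirstOrder.Language.Theory.ModelType.{u, v, max u v} CT) (n : ℕ) (f : L.Functions n)
    (xs ys : Fin n → M),
    FirstOrder.Language.Structure.funMap f xs = FirstOrder.Language.Structure.funMap f ys → xs = ys
  clash : ∀ (M : FirstOrder.Language.Theory.ModelType.{u, v, max u v} CT) (n m : ℕ) (f : L.Functions n)
    (g : L.Functions m) (xs : Fin n → M) (ys : Fin m → M),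
    (⟨n, f⟩ : Σ k, L.Functions k) ≠ ⟨m, g⟩ →
      FirstOrder.Language.Structure.funMap f xs ≠ FirstOrder.Language.Structure.funMap g ys
  occurs : ∀ (M : FirstOrder.Language.Theory.ModelType.{u, v, max u v} CT) (x : Var) (t : L.Term Var),
    x ∈ t.varFinset → t ≠ FirstOrder.Language.Term.var x → ∀ a : Var → M, a x ≠ t.realize a

end Entailment

/-! ### Syntax of annotated programs -/

/-- A CHR (user-defined) constraint `p(t₁, …, tₖ)`; a predicate symbol is a name with an arity. -/
structure Atom (L : FirstOrder.Language.{u, v}) (Pr : Type w) where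
  pred : Pr
  args : List (L.Term Var)

/-- An identified CHR constraint `h#i`. -/
structure IdAtom (L : FirstOrder.Language.{u, v}) (Pr : Type w) where
  atom : Atom L Pr
  id : ℕ

/-- A token `r@i₁,…,iₗ`. -/
structure Token (Nm : Type z) where
  name : Nm
  ids : List ℕ

/-- An annotated rule `name @ keep \ remove ⇔ guard | body ; tokens`; the body is split into its
identified CHR constraints and its built-in constraints. -/
structure Rule (L : FirstOrder.Language.{u, v}) (Pr : Type w) (Nm : Type z) where
  name : Nm
  keep : List (Atom L Pr)
  remove : List (Atom L Pr)
  guard : Multiset (BuiltIn L)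
  bodyChr : Multiset (IdAtom L Pr)
  bodyBuiltIn : Multiset (BuiltIn L)
  tokens : Set (Token Nm)

section Basics

variable {L : FirstOrder.Language.{u, v}} {Pr : Type w} {Nm : Type z}

/-- The renaming substitution given by a permutation of the variables. -/
def varRenaming (π : Equiv.Perm Var) : Var → L.Term Var := fun x => FirstOrder.Language.Term.var (π x)

def Atom.subst (θ : Var → L.Term Var) (h : Atom L Pr) : Atom L Pr :=
  ⟨h.pred, h.args.map fun t => t.subst θ⟩

def Atom.fv (h : Atom L Pr) : Set Var := {x | ∃ t ∈ h.args, x ∈ t.varFinset}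

def IdAtom.subst (θ : Var → L.Term Var) (h : IdAtom L Pr) : IdAtom L Pr :=
  ⟨h.atom.subst θ, h.id⟩

/-- Apply a function to the identifiers. -/
def IdAtom.mapId (f : ℕ → ℕ) (h : IdAtom L Pr) : IdAtom L Pr := ⟨h.atom, f h.id⟩

def Token.mapId (f : ℕ → ℕ) (t : Token Nm) : Token Nm := ⟨t.name, t.ids.map f⟩

/-- The set of identifiers of the CHR constraints in `B`. -/
def idSet (B : Multiset (IdAtom L Pr)) : Set ℕ := {i | ∃ h ∈ B, h.id = i}

/-- The set of identifiers occurring in a token store. -/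
def tokenIdSet (T : Set (Token Nm)) : Set ℕ := {i | ∃ t ∈ T, i ∈ t.ids}

/-- The greatest identifier occurring in `B` and `T` (and `0` if there is none). -/
noncomputable def maxId (B : Multiset (IdAtom L Pr)) (T : Set (Token Nm)) : ℕ :=
  sSup (idSet B ∪ tokenIdSet T)

/-- `inst (B, T, n) = (B', T', m)`: all identifiers are incremented by `n`, and `m` is the greatest
resulting identifier (`m = n` if there are no identifiers). -/
noncomputable def inst (B : Multiset (IdAtom L Pr)) (T : Set (Token Nm)) (n : ℕ) :
    Multiset (IdAtom L Pr) × Set (Token Nm) × ℕ :=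
  (B.map (IdAtom.mapId fun i => i + n), Token.mapId (fun i => i + n) '' T, n + maxId B T)

/-- `clean (B, T)`: the tokens of `T` all of whose identifiers are present in `B`. -/
def clean (B : Multiset (IdAtom L Pr)) (T : Set (Token Nm)) : Set (Token Nm) :=
  {t ∈ T | ∀ i ∈ t.ids, i ∈ idSet B}

/-- `h` and `k` have the same predicate symbol (name and arity). -/
def SameSymbol (h k : Atom L Pr) : Prop := h.pred = k.pred ∧ h.args.length = k.args.length

/-- The equation `H = H'` between sequences of CHR constraints is defined. -/
def Comparable (H H' : List (Atom L Pr)) : Prop := List.Forall₂ SameSymbol H H'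

/-- The set of equations `H = H'` (meaningful when the two sequences are comparable). -/
def equations (H H' : List (Atom L Pr)) : List (BuiltIn L) :=
  (List.zipWith (fun h k => List.zipWith BuiltIn.eq h.args k.args) H H').flatten

/-- The conjunction of a list of built-in constraints and `C`. -/
def conj (E : List (BuiltIn L)) (C : BuiltIn L) : BuiltIn L := E.foldr BuiltIn.and C

/-- `chr (H)` for a sequence of identified constraints. -/
def chr (H : List (IdAtom L Pr)) : List (Atom L Pr) := H.map IdAtom.atom

namespace Rule

/-- The whole head, as a sequence. -/
def head (r : Rule L Pr Nm) : List (Atom L Pr) := r.keep ++ r.remove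

def headFv (r : Rule L Pr Nm) : Set Var := {x | ∃ h ∈ r.head, x ∈ h.fv}

/-- All free variables of a rule. -/
def fv (r : Rule L Pr Nm) : Set Var :=
  r.headFv ∪ {x | ∃ c ∈ r.guard, x ∈ c.fv} ∪ {x | ∃ h ∈ r.bodyChr, x ∈ h.atom.fv} ∪
    {x | ∃ c ∈ r.bodyBuiltIn, x ∈ c.fv}

/-- The variant of a rule obtained by renaming its variables. -/
def rename (π : Equiv.Perm Var) (r : Rule L Pr Nm) : Rule L Pr Nm where
  name := r.name
  keep := r.keep.map (Atom.subst (varRenaming π))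
  remove := r.remove.map (Atom.subst (varRenaming π))
  guard := r.guard.map (BuiltIn.subst (varRenaming π))
  bodyChr := r.bodyChr.map (IdAtom.subst (varRenaming π))
  bodyBuiltIn := r.bodyBuiltIn.map (BuiltIn.subst (varRenaming π))
  tokens := r.tokens

/-- The requirements on an annotated rule: its head is non-empty, different occurrences of CHR
constraints in its body have different identifiers, identifiers are positive, and the local token
store only refers to identifiers of the body. -/
structure WellFormed (r : Rule L Pr Nm) : Prop where
  head_ne : r.head ≠ []
  nodup : (r.bodyChr.map IdAtom.id).Nodup
  pos : ∀ h ∈ r.bodyChr, 0 < h.id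
  tokens_sub : tokenIdSet r.tokens ⊆ idSet r.bodyChr

end Rule

/-- An annotated program: a set of annotated rules (names need not be unique). Finiteness is not
required: the set of all unfoldings of a rule contains all
their variants, so that it is infinite even over a finite program. -/
def IsAnnotatedProgram (P : Set (Rule L Pr Nm)) : Prop := ∀ r ∈ P, r.WellFormed

end Basics

/-! ### Operational semantics -/

/-- A configuration `⟨S̃, c, T⟩ₙ`; the store `S̃` is split into its identified CHR constraints and
its pending built-in constraints. -/
structure Config (L : FirstOrder.Language.{u, v}) (Pr : Type w) (Nm : Type z) where
  chrs : Multiset (IdAtom L Pr)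
  pending : Multiset (BuiltIn L)
  store : BuiltIn L
  tokens : Set (Token Nm)
  counter : ℕ

section Semantics

variable {L : FirstOrder.Language.{u, v}} {Pr : Type w} {Nm : Type z}

namespace Config

def fv (σ : Config L Pr Nm) : Set Var :=
  {x | ∃ h ∈ σ.chrs, x ∈ h.atom.fv} ∪ {x | ∃ c ∈ σ.pending, x ∈ c.fv} ∪ σ.store.fv

/-- The identifiers of the CHR constraints are distinct, and the counter bounds all identifiers
used so far. -/
structure WellFormed (σ : Config L Pr Nm) : Prop where
  nodup : (σ.chrs.map IdAtom.id).Nodup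
  ids_le : ∀ i ∈ idSet σ.chrs, i ≤ σ.counter
  tokens_le : ∀ i ∈ tokenIdSet σ.tokens, i ≤ σ.counter

/-- Failed configurations: the built-in store is `false`, i.e. inconsistent. -/
def Failed (CT : L.Theory) (σ : Config L Pr Nm) : Prop := ¬ Satisfiable CT {σ.store}

/-- Built-in free configurations. -/
def BuiltInFree (CT : L.Theory) (σ : Config L Pr Nm) : Prop := σ.Failed CT ∨ σ.pending = 0

end Config

/-- A stage of a derivation: the current configuration, together with the set of all variables
that have been used in the derivation so far. -/
structure Stage (L : FirstOrder.Language.{u, v}) (Pr : Type w) (Nm : Type z) where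
  used : Set Var
  cfg : Config L Pr Nm

/-- The stage in which a derivation from `σ` starts. -/
def Stage.start (σ : Config L Pr Nm) : Stage L Pr Nm := ⟨σ.fv, σ⟩

/-- The transition Solve'. Failed configurations are final. -/
inductive SolveStep (CT : L.Theory) : Stage L Pr Nm → Stage L Pr Nm → Prop
  | mk (U : Set Var) (S : Multiset (IdAtom L Pr)) (c : BuiltIn L) (G : Multiset (BuiltIn L))
      (C C' : BuiltIn L) (T : Set (Token Nm)) (n : ℕ)
      (hfail : ¬ Config.Failed CT (⟨S, c ::ₘ G, C, T, n⟩ : Config L Pr Nm))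
      (hC : Equivalent CT {c.and C} {C'}) :
      SolveStep CT ⟨U, ⟨S, c ::ₘ G, C, T, n⟩⟩ ⟨U ∪ C'.fv, ⟨S, G, C', T, n⟩⟩

open Classical in
/-- The transition Apply', with a variant of a rule of `P` that is renamed apart from all the
variables used in the derivation so far. Failed configurations are final. -/
inductive ApplyStep (CT : L.Theory) (P : Set (Rule L Pr Nm)) :
    Stage L Pr Nm → Stage L Pr Nm → Prop
  | mk (U : Set Var) (H₁ H₂ : List (IdAtom L Pr)) (G : Multiset (IdAtom L Pr))
      (Q : Multiset (BuiltIn L)) (C : BuiltIn L) (T : Set (Token Nm)) (n : ℕ)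
      (r₀ r : Rule L Pr Nm) (π : Equiv.Perm Var) (B' : Multiset (IdAtom L Pr))
      (Tr : Set (Token Nm)) (m : ℕ)
      (hfail : ¬ Config.Failed CT (⟨↑H₁ + ↑H₂ + G, Q, C, T, n⟩ : Config L Pr Nm))
      (hr₀ : r₀ ∈ P) (hr : r = r₀.rename π) (hfresh : Disjoint r.fv U)
      (hH₁ : Comparable (chr H₁) r.keep) (hH₂ : Comparable (chr H₂) r.remove)
      (hguard : EntailsEx CT {C} r.headFv (↑(equations (chr (H₁ ++ H₂)) r.head) + r.guard))
      (htoken : (⟨r.name, (H₁ ++ H₂).map IdAtom.id⟩ : Token Nm) ∉ T)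
      (hinst : inst r.bodyChr r.tokens n = (B', Tr, m)) :
      ApplyStep CT P
        ⟨U, ⟨↑H₁ + ↑H₂ + G, Q, C, T, n⟩⟩
        ⟨U ∪ r.fv,
          ⟨B' + ↑H₁ + G, r.bodyBuiltIn + Q, conj (equations (chr (H₁ ++ H₂)) r.head) C,
            T ∪ Tr ∪ (if H₂ = [] then {⟨r.name, (H₁ ++ H₂).map IdAtom.id⟩} else ∅), m⟩⟩

/-- One transition of `ω'ₜ`. -/
def Step (CT : L.Theory) (P : Set (Rule L Pr Nm)) (s s' : Stage L Pr Nm) : Prop :=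
  SolveStep CT s s' ∨ ApplyStep CT P s s'

/-- One transition of a normal derivation: Apply' is used only on built-in free configurations. -/
def NormalStep (CT : L.Theory) (P : Set (Rule L Pr Nm)) (s s' : Stage L Pr Nm) : Prop :=
  SolveStep CT s s' ∨ (s.cfg.BuiltInFree CT ∧ ApplyStep CT P s s')

/-- There are no infinite normal derivations. -/
def NormalTerminating (CT : L.Theory) (P : Set (Rule L Pr Nm)) : Prop :=
  ∀ σ : Config L Pr Nm, σ.WellFormed →
    ¬ ∃ s : ℕ → Stage L Pr Nm, s 0 = Stage.start σ ∧ ∀ i, NormalStep CT P (s i) (s (i + 1))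

/-- `σ₁ ≃'_V σ₂`: both are failed, or they are identical up to renaming of variables not in `V`,
renaming of identifiers, cleaning of the token store, and logical equivalence of built-in
constraints. -/
def EquivUpTo (CT : L.Theory) (V : Set Var) (σ₁ σ₂ : Config L Pr Nm) : Prop :=
  (σ₁.Failed CT ∧ σ₂.Failed CT) ∨
    ∃ (π : Equiv.Perm Var) (ρ : Equiv.Perm ℕ), (∀ x ∈ V, π x = x) ∧
      σ₁.chrs.map (fun h => (h.subst (varRenaming π)).mapId ρ) = σ₂.chrs ∧
      Multiset.Rel (fun c d => Equivalent CT {c.subst (varRenaming π)} {d}) σ₁.pending σ₂.pending ∧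
      Equivalent CT {σ₁.store.subst (varRenaming π)} {σ₂.store} ∧
      Token.mapId ρ '' clean σ₁.chrs σ₁.tokens = clean σ₂.chrs σ₂.tokens

/-- Any two normal derivations from the same configuration can be continued to configurations that
are equivalent up to renaming of the variables not occurring in the initial one. -/
def NormalConfluent (CT : L.Theory) (P : Set (Rule L Pr Nm)) : Prop :=
  ∀ (σ : Config L Pr Nm) (s₁ s₂ : Stage L Pr Nm), σ.WellFormed →
    Relation.ReflTransGen (NormalStep CT P) (Stage.start σ) s₁ →
    Relation.ReflTransGen (NormalStep CT P) (Stage.start σ) s₂ →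
    ∃ f₁ f₂ : Stage L Pr Nm,
      Relation.ReflTransGen (Step CT P) s₁ f₁ ∧ Relation.ReflTransGen (Step CT P) s₂ f₂ ∧
      EquivUpTo CT σ.fv f₁.cfg f₂.cfg

end Semantics

/-! ### Unfolding -/

section Unfolding

variable {L : FirstOrder.Language.{u, v}} {Pr : Type w} {Nm : Type z}

open Classical in
/-- `IsUnfolding CT r v r'`: the annotated rule `r'` is obtained by unfolding `r` with a variant
(renamed apart from `r`) of the annotated rule `v`. The CHR constraints of the body of `r` are split
into `K, S₁, S₂`, where `chr (S₁, S₂)` is matched by the head of `v` via the substitution `θ`. -/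
inductive IsUnfolding (CT : L.Theory) (r : Rule L Pr Nm) : Rule L Pr Nm → Rule L Pr Nm → Prop
  | mk (v₀ v : Rule L Pr Nm) (π : Equiv.Perm Var) (K : Multiset (IdAtom L Pr))
      (S₁ S₂ : List (IdAtom L Pr)) (θ : Var → L.Term Var) (D'' : Multiset (BuiltIn L))
      (B₁ : Multiset (IdAtom L Pr)) (T₁ : Set (Token Nm)) (m₁ : ℕ)
      (hv : v = v₀.rename π) (happart : Disjoint v.fv r.fv)
      (hbody : r.bodyChr = K + ↑S₁ + ↑S₂)
      (hS₁ : Comparable (chr S₁) v.keep) (hS₂ : Comparable (chr S₂) v.remove)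
      (hθ : ∀ x, x ∉ v.headFv → θ x = FirstOrder.Language.Term.var x)
      (hmatch : Entails CT (r.bodyBuiltIn + r.guard)
        ↑(equations (chr (S₁ ++ S₂)) (v.head.map (Atom.subst θ))))
      (htoken : (⟨v.name, (S₁ ++ S₂).map IdAtom.id⟩ : Token Nm) ∉ r.tokens)
      (hD'' : D'' = v.guard.filter
        fun c => ¬ Entails CT (r.bodyBuiltIn + r.guard) {c.subst θ})
      (hsat : Satisfiable CT (r.guard + D''.map (BuiltIn.subst θ)))
      (hinst : inst v.bodyChr v.tokens (maxId r.bodyChr r.tokens) = (B₁, T₁, m₁)) :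
      IsUnfolding CT r v₀
        { name := r.name
          keep := r.keep
          remove := r.remove
          guard := r.guard + D''.map (BuiltIn.subst θ)
          bodyChr := K + ↑S₁ + B₁
          bodyBuiltIn := v.bodyBuiltIn + r.bodyBuiltIn + ↑(equations (chr (S₁ ++ S₂)) v.head)
          tokens := clean (K + ↑S₁) r.tokens ∪ T₁ ∪
            (if v.remove = [] then {⟨v.name, S₁.map IdAtom.id⟩} else ∅) }

/-- `Unf_P (r)`: all the rules obtained by unfolding `r` with a rule of `P`. -/
def Unf (CT : L.Theory) (P : Set (Rule L Pr Nm)) (r : Rule L Pr Nm) : Set (Rule L Pr Nm) :=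
  {r' | ∃ v ∈ P, IsUnfolding CT r v r'}

/-- The rule `r` of `P` can be weakly safely replaced (by its unfolded version) in `P`. -/
def WeaklySafelyReplaceable (CT : L.Theory) (P : Set (Rule L Pr Nm)) (r : Rule L Pr Nm) : Prop :=
  r ∈ P ∧ ∃ r' ∈ Unf CT P r, Equivalent CT r.guard r'.guard

end Unfolding

end CHR

namespace CHR

open FirstOrder Language

/-! ### Substitution, renaming and free variables in terms and built-in constraints. -/

section Formulas

variable {L : FirstOrder.Language.{u, v}}

/-! Normal derivations of the transformed program P' are simulated by normal derivations of P from
the same configuration that solve built-in constraints eagerly. The relation `Simulates` compares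
stages through `Config.Flat`, the conjunction of the store and the pending constraints, so a Solve'
step of P' needs no answer. An Apply' step with a rule kept from P is repeated with other fresh
names (`exists_transfer`). An Apply' step with an unfolding of r by v is answered by applying r,
solving, applying v to the body constraints of r and solving again
(`IsUnfolding.exists_simulation`); if the first solving fails, the unfolded result is inconsistent
as well. The delicate point is that the guard of the unfolding is known only for some values of its
head variables, whereas v needs it for the values fixed by the store after r. Injectivity of
function symbols makes the two coincide (`Applicable.eq_of_holds`).

Termination is a lexicographic descent: each Apply' of P' costs at least one step of P, and each
Solve' consumes a pending constraint while P stands still (`Simulates.acc`).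

For confluence, termination extends both derivations of P' to stuck stages. The stages of P
simulating them have the same outcome and are stuck too (`Simulates.of_stuck`). Weak safe
replacement enters only here: an unfolding with the head of r and a guard equivalent to that of r
applies, up to fresh names, wherever r does. Confluence of P therefore relates the two stuck stages
of P themselves, and the relation is carried back to P' along the matches. -/

theorem term_realize_congr {α : Type*} [DecidableEq α] {M : Type*} [L.Structure M] {a b : α → M}
    (t : L.Term α) (h : ∀ x ∈ t.varFinset, a x = b x) : t.realize a = t.realize b := by
  induction t with
  | var x => exact h x (by simp)
  | func f ts ih =>
    simp only [Term.realize_func]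
    congr 1
    funext i
    exact ih i fun x hx => h x (by simpa using ⟨i, hx⟩)

theorem term_realize_sum_congr {α β : Type*} [DecidableEq α] {M : Type*} [L.Structure M]
    {a b : α → M} (e : β → M) (t : L.Term (α ⊕ β)) (h : ∀ x ∈ t.varFinsetLeft, a x = b x) :
    t.realize (Sum.elim a e) = t.realize (Sum.elim b e) := by
  induction t with
  | var x =>
    cases x with
    | inl x => exact h x (by simp)
    | inr x => rfl
  | func f ts ih =>
    simp only [Term.realize_func]
    congr 1
    funext i
    exact ih i fun x hx => h x (by simpa using ⟨i, hx⟩)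

theorem term_subst_congr {α β : Type*} [DecidableEq α] {f g : α → L.Term β} (t : L.Term α)
    (h : ∀ x ∈ t.varFinset, f x = g x) : t.subst f = t.subst g := by
  induction t with
  | var x => exact h x (by simp)
  | func F ts ih =>
    simp only [Term.subst]
    congr 1
    funext i
    exact ih i fun x hx => h x (by simpa using ⟨i, hx⟩)

theorem term_subst_subst {α β γ : Type*} (f : α → L.Term β) (g : β → L.Term γ) (t : L.Term α) :
    (t.subst f).subst g = t.subst fun x => (f x).subst g := by
  induction t with
  | var x => rfl
  | func F ts ih => simp only [Term.subst, ih]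

theorem term_subst_var {α : Type*} (t : L.Term α) : t.subst Term.var = t := by
  induction t with
  | var x => rfl
  | func F ts ih => simp only [Term.subst, ih]

theorem mem_varFinset_rename (π : Equiv.Perm Var) (t : L.Term Var) (x : Var) :
    x ∈ (t.subst (varRenaming π)).varFinset ↔ π.symm x ∈ t.varFinset := by
  induction t with
  | var y => simp [varRenaming, Equiv.symm_apply_eq]
  | func F ts ih => simp [Term.subst, ih]

theorem mem_varFinsetLeft_rename {β : Type*} (π : Equiv.Perm Var) (t : L.Term (Var ⊕ β))
    (x : Var) :
    x ∈ (t.subst (Sum.elim (Term.relabel Sum.inl ∘ varRenaming π)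
      (Term.var ∘ Sum.inr))).varFinsetLeft ↔ π.symm x ∈ t.varFinsetLeft := by
  induction t with
  | var y => cases y <;> simp [varRenaming, Equiv.symm_apply_eq]
  | func F ts ih => simp [Term.subst, ih]

theorem varFinsetLeft_relabel_inl {α β : Type*} [DecidableEq α] (t : L.Term α) :
    (t.relabel (Sum.inl : α → α ⊕ β)).varFinsetLeft = t.varFinset := by
  induction t with
  | var y => simp
  | func F ts ih => simp [ih]

/-- Function symbols being injective, the value of a term determines the values of its variables. -/
theorem ClarkEquality.eq_of_realize_eq {CT : L.Theory} (hCT : ClarkEquality CT)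
    (M : FirstOrder.Language.Theory.ModelType.{u, v, max u v} CT) {a b : Var → M} (t : L.Term Var)
    (h : t.realize a = t.realize b) : ∀ x ∈ t.varFinset, a x = b x := by
  induction t with
  | var y =>
    intro x hx
    obtain rfl : x = y := by simpa using hx
    exact h
  | func f ts ih =>
    intro x hx
    obtain ⟨i, hi⟩ : ∃ i, x ∈ (ts i).varFinset := by simpa using hx
    exact ih i (congrFun (hCT.injective M _ f _ _ h) i) x hi

theorem boundedFormula_realize_congr {α : Type*} [DecidableEq α] {M : Type*} [L.Structure M]
    {a b : α → M} {n : ℕ} (φ : L.BoundedFormula α n) (h : ∀ x ∈ φ.freeVarFinset, a x = b x)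
    (e : Fin n → M) : φ.Realize a e ↔ φ.Realize b e := by
  induction φ with
  | falsum => exact Iff.rfl
  | equal t₁ t₂ =>
    simp only [BoundedFormula.freeVarFinset, Finset.mem_union] at h
    simp only [BoundedFormula.Realize,
      term_realize_sum_congr e t₁ fun x hx => h x (Or.inl hx),
      term_realize_sum_congr e t₂ fun x hx => h x (Or.inr hx)]
  | rel R ts =>
    simp only [BoundedFormula.Realize]
    have : ∀ i, (ts i).realize (Sum.elim a e) = (ts i).realize (Sum.elim b e) := fun i =>
      term_realize_sum_congr e (ts i) fun x hx => h x (by simpa using ⟨i, hx⟩)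
    simp only [this]
  | imp f₁ f₂ ih₁ ih₂ =>
    simp only [BoundedFormula.freeVarFinset, Finset.mem_union] at h
    simp only [BoundedFormula.Realize, ih₁ (fun x hx => h x (Or.inl hx)),
      ih₂ (fun x hx => h x (Or.inr hx))]
  | all f ih => exact forall_congr' fun x => ih h _

theorem mem_freeVarFinset_rename (π : Equiv.Perm Var) {n : ℕ} (φ : L.BoundedFormula Var n)
    (x : Var) :
    x ∈ (φ.subst (varRenaming π)).freeVarFinset ↔ π.symm x ∈ φ.freeVarFinset := by
  induction φ with
  | falsum => simp [BoundedFormula.subst, BoundedFormula.mapTermRel]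
  | equal t₁ t₂ =>
    simp only [BoundedFormula.subst, BoundedFormula.mapTermRel, BoundedFormula.freeVarFinset,
      Finset.mem_union, mem_varFinsetLeft_rename]
  | rel R ts =>
    simp only [BoundedFormula.subst, BoundedFormula.mapTermRel, BoundedFormula.freeVarFinset,
      Finset.mem_biUnion, Finset.mem_univ, true_and, mem_varFinsetLeft_rename]
  | imp f₁ f₂ ih₁ ih₂ =>
    simp only [BoundedFormula.subst, BoundedFormula.mapTermRel, BoundedFormula.freeVarFinset,
      Finset.mem_union] at *
    rw [ih₁, ih₂]
  | all f ih => exact ih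

theorem boundedFormula_rename_rename (π τ : Equiv.Perm Var) {n : ℕ} (φ : L.BoundedFormula Var n) :
    (φ.subst (varRenaming π)).subst (varRenaming τ) = φ.subst (varRenaming (π.trans τ)) := by
  -- Inside quantifiers a substitution is extended by the identity on bound variables; this
  -- extension respects composition of renamings.
  have key : ∀ (k : ℕ) (t : L.Term (Var ⊕ Fin k)),
      (t.subst (Sum.elim (Term.relabel Sum.inl ∘ varRenaming π) (Term.var ∘ Sum.inr))).subst
        (Sum.elim (Term.relabel Sum.inl ∘ varRenaming τ) (Term.var ∘ Sum.inr)) =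
      t.subst (Sum.elim (Term.relabel Sum.inl ∘ varRenaming (π.trans τ))
        (Term.var ∘ Sum.inr)) := by
    intro k t
    rw [term_subst_subst]
    congr 1
    funext x
    cases x <;> rfl
  induction φ with
  | falsum => rfl
  | equal t₁ t₂ =>
    simp only [BoundedFormula.subst, BoundedFormula.mapTermRel, key]
  | rel R ts => simp only [BoundedFormula.subst, BoundedFormula.mapTermRel, key, id]
  | imp f₁ f₂ ih₁ ih₂ =>
    simp only [BoundedFormula.subst, BoundedFormula.mapTermRel] at *
    rw [ih₁, ih₂]
  | all f ih =>
    simp only [BoundedFormula.subst, BoundedFormula.mapTermRel, id] at *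
    rw [ih]

namespace BuiltIn

theorem holds_congr {M : Type*} [L.Structure M] (c : BuiltIn L) {a b : Var → M}
    (h : ∀ x ∈ c.fv, a x = b x) : c.Holds a ↔ c.Holds b :=
  boundedFormula_realize_congr c.1 h _

theorem holds_subst {M : Type*} [L.Structure M] (c : BuiltIn L) (θ : Var → L.Term Var)
    (a : Var → M) : (c.subst θ).Holds a ↔ c.Holds fun x => (θ x).realize a :=
  BoundedFormula.realize_subst

theorem holds_rename {M : Type*} [L.Structure M] (c : BuiltIn L) (π : Equiv.Perm Var)
    (a : Var → M) : (c.subst (varRenaming π)).Holds a ↔ c.Holds (a ∘ π) :=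
  BoundedFormula.realize_subst

theorem mem_fv_rename (π : Equiv.Perm Var) (c : BuiltIn L) (x : Var) :
    x ∈ (c.subst (varRenaming π)).fv ↔ π.symm x ∈ c.fv :=
  mem_freeVarFinset_rename π c.1 x

theorem rename_rename (π τ : Equiv.Perm Var) (c : BuiltIn L) :
    (c.subst (varRenaming π)).subst (varRenaming τ) = c.subst (varRenaming (π.trans τ)) :=
  Subtype.ext (boundedFormula_rename_rename π τ c.1)

theorem holds_and {M : Type*} [L.Structure M] (c d : BuiltIn L) (a : Var → M) :
    (c.and d).Holds a ↔ c.Holds a ∧ d.Holds a :=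
  BoundedFormula.realize_inf

theorem holds_eq {M : Type*} [L.Structure M] (s t : L.Term Var) (a : Var → M) :
    (BuiltIn.eq s t).Holds a ↔ s.realize a = t.realize a :=
  Formula.realize_equal

theorem fv_and (c d : BuiltIn L) : (c.and d).fv = c.fv ∪ d.fv := by
  ext x
  change x ∈ ((c.1.freeVarFinset ∪ (d.1.freeVarFinset ∪ ∅)) ∪ ∅ : Finset Var) ↔ _
  simp [fv]

theorem fv_eq (s t : L.Term Var) : (BuiltIn.eq s t).fv = ↑s.varFinset ∪ ↑t.varFinset := by
  ext x
  change x ∈ ((s.relabel Sum.inl).varFinsetLeft ∪ (t.relabel Sum.inl).varFinsetLeft : Finset Var) ↔ _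
  simp [varFinsetLeft_relabel_inl]

theorem finite_fv (c : BuiltIn L) : c.fv.Finite := Finset.finite_toSet _

end BuiltIn

theorem holds_conj {M : Type*} [L.Structure M] (E : List (BuiltIn L)) (C : BuiltIn L)
    (a : Var → M) : (conj E C).Holds a ↔ (∀ c ∈ E, c.Holds a) ∧ C.Holds a := by
  induction E with
  | nil => simp [conj]
  | cons c E ih =>
    change (c.and (conj E C)).Holds a ↔ _
    rw [BuiltIn.holds_and, ih]
    simp [and_assoc]

theorem mem_fv_conj (E : List (BuiltIn L)) (C : BuiltIn L) (x : Var) :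
    x ∈ (conj E C).fv ↔ (∃ c ∈ E, x ∈ c.fv) ∨ x ∈ C.fv := by
  induction E with
  | nil => simp [conj]
  | cons c E ih =>
    change x ∈ (c.and (conj E C)).fv ↔ _
    rw [BuiltIn.fv_and, Set.mem_union, ih]
    simp [or_assoc]

end Formulas

/-! ### CHR atoms, their values, and equations between sequences of atoms. -/

section Atoms

variable {L : FirstOrder.Language.{u, v}} {Pr : Type w} {Nm : Type z}

/-- The values of the arguments of an atom. -/
def Atom.eval {M : Type*} [L.Structure M] (a : Var → M) (h : Atom L Pr) : List M :=
  h.args.map fun t => t.realize a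

theorem Atom.eval_subst {M : Type*} [L.Structure M] (a : Var → M) (θ : Var → L.Term Var)
    (h : Atom L Pr) : (h.subst θ).eval a = h.eval fun x => (θ x).realize a := by
  simp only [Atom.eval, Atom.subst, List.map_map]
  congr 1
  funext t
  exact Term.realize_subst

theorem Atom.eval_congr {M : Type*} [L.Structure M] {a b : Var → M} (h : Atom L Pr)
    (hab : ∀ x ∈ h.fv, a x = b x) : h.eval a = h.eval b :=
  List.map_congr_left fun t ht => term_realize_congr t fun x hx => hab x ⟨t, ht, hx⟩

theorem Atom.mem_fv_rename (π : Equiv.Perm Var) (h : Atom L Pr) (x : Var) :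
    x ∈ (h.subst (varRenaming π)).fv ↔ π.symm x ∈ h.fv := by
  simp only [Atom.fv, Atom.subst, Set.mem_ofPred_eq, List.mem_map]
  constructor
  · rintro ⟨_, ⟨t, ht, rfl⟩, hx⟩
    exact ⟨t, ht, (mem_varFinset_rename π t x).1 hx⟩
  · rintro ⟨t, ht, hx⟩
    exact ⟨_, ⟨t, ht, rfl⟩, (mem_varFinset_rename π t x).2 hx⟩

theorem Atom.subst_congr {f g : Var → L.Term Var} (h : Atom L Pr) (hfg : ∀ x ∈ h.fv, f x = g x) :
    h.subst f = h.subst g := by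
  simp only [Atom.subst, Atom.mk.injEq, true_and]
  exact List.map_congr_left fun t ht => term_subst_congr t fun x hx => hfg x ⟨t, ht, hx⟩

theorem Atom.rename_rename (π τ : Equiv.Perm Var) (h : Atom L Pr) :
    (h.subst (varRenaming π)).subst (varRenaming τ) = h.subst (varRenaming (π.trans τ)) := by
  simp only [Atom.subst, List.map_map, Atom.mk.injEq, true_and]
  congr 1
  funext t
  exact term_subst_subst _ _ t

theorem Atom.subst_var (h : Atom L Pr) : h.subst Term.var = h := by
  cases h
  simp [Atom.subst, term_subst_var]

theorem Atom.finite_fv (h : Atom L Pr) : h.fv.Finite := by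
  refine ((List.finite_toSet h.args).biUnion (t := fun t => (t.varFinset : Set Var)) fun t _ =>
    t.varFinset.finite_toSet).subset ?_
  rintro x ⟨t, ht, hx⟩
  exact Set.mem_biUnion ht hx

theorem ClarkEquality.eq_of_eval_eq {CT : L.Theory} (hCT : ClarkEquality CT)
    (M : FirstOrder.Language.Theory.ModelType.{u, v, max u v} CT) {a b : Var → M} (h : Atom L Pr)
    (heq : h.eval a = h.eval b) : ∀ x ∈ h.fv, a x = b x := by
  rintro x ⟨t, ht, hx⟩
  exact hCT.eq_of_realize_eq M t (List.map_inj_left.1 heq t ht) x hx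

theorem SameSymbol.rename_iff (h k : Atom L Pr) (f g : Var → L.Term Var) :
    SameSymbol (h.subst f) (k.subst g) ↔ SameSymbol h k := by
  simp [SameSymbol, Atom.subst]

theorem comparable_subst_iff {H H' : List (Atom L Pr)} (f g : Var → L.Term Var) :
    Comparable (H.map (Atom.subst f)) (H'.map (Atom.subst g)) ↔ Comparable H H' := by
  unfold Comparable
  rw [List.forall₂_map_left_iff, List.forall₂_map_right_iff]
  simp only [SameSymbol.rename_iff]

theorem comparable_subst_right_iff {H H' : List (Atom L Pr)} (g : Var → L.Term Var) :
    Comparable H (H'.map (Atom.subst g)) ↔ Comparable H H' := by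
  unfold Comparable
  rw [List.forall₂_map_right_iff]
  simp only [SameSymbol, Atom.subst, List.length_map]
  exact Iff.rfl

/-- Equations between comparable sequences of atoms say that corresponding arguments have the same
values. -/
theorem forall_equations_holds_iff {M : Type*} [L.Structure M] (a : Var → M)
    {H H' : List (Atom L Pr)} (h : Comparable H H') :
    (∀ c ∈ equations H H', c.Holds a) ↔ H.map (Atom.eval a) = H'.map (Atom.eval a) := by
  have key : ∀ l l' : List (L.Term Var), l.length = l'.length →
      ((∀ c ∈ List.zipWith BuiltIn.eq l l', c.Holds a) ↔
        l.map (fun t => t.realize a) = l'.map (fun t => t.realize a)) := by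
    intro l
    induction l with
    | nil => intro l' hl; cases l' <;> simp_all
    | cons s l ih =>
      intro l' hl
      cases l' with
      | nil => simp at hl
      | cons t l' => simp [BuiltIn.holds_eq, ih l' (by simpa using hl)]
  unfold Comparable at h
  induction h with
  | nil => simp [equations]
  | @cons p q H H' hpq _ ih =>
    have e : equations (p :: H) (q :: H') =
        List.zipWith BuiltIn.eq p.args q.args ++ equations H H' := rfl
    rw [e]
    simp only [List.mem_append, or_imp, forall_and, ih, key _ _ hpq.2, List.map_cons,
      List.cons.injEq]
    rfl

theorem fv_equations {H H' : List (Atom L Pr)} {c : BuiltIn L} (hc : c ∈ equations H H') {x : Var}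
    (hx : x ∈ c.fv) : (∃ h ∈ H, x ∈ h.fv) ∨ ∃ h ∈ H', x ∈ h.fv := by
  have key : ∀ l l' : List (L.Term Var), c ∈ List.zipWith BuiltIn.eq l l' →
      (∃ t ∈ l, x ∈ t.varFinset) ∨ ∃ t ∈ l', x ∈ t.varFinset := by
    intro l
    induction l with
    | nil => simp
    | cons s l ih =>
      intro l' hl
      cases l' with
      | nil => simp at hl
      | cons t l' =>
        simp only [List.zipWith_cons_cons, List.mem_cons] at hl
        rcases hl with rfl | hl
        · rw [BuiltIn.fv_eq] at hx
          rcases hx with hx | hx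
          · exact Or.inl ⟨s, by simp, hx⟩
          · exact Or.inr ⟨t, by simp, hx⟩
        · rcases ih l' hl with ⟨t, ht, h⟩ | ⟨t, ht, h⟩
          · exact Or.inl ⟨t, by simp [ht], h⟩
          · exact Or.inr ⟨t, by simp [ht], h⟩
  induction H generalizing H' with
  | nil => simp [equations] at hc
  | cons p H ih =>
    cases H' with
    | nil => simp [equations] at hc
    | cons q H' =>
      have e : equations (p :: H) (q :: H') =
        List.zipWith BuiltIn.eq p.args q.args ++ equations H H' := rfl
      rw [e, List.mem_append] at hc
      rcases hc with hc | hc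
      · rcases key _ _ hc with ⟨t, ht, h⟩ | ⟨t, ht, h⟩
        · exact Or.inl ⟨p, by simp, t, ht, h⟩
        · exact Or.inr ⟨q, by simp, t, ht, h⟩
      · rcases ih hc with ⟨t, ht, h⟩ | ⟨t, ht, h⟩
        · exact Or.inl ⟨t, by simp [ht], h⟩
        · exact Or.inr ⟨t, by simp [ht], h⟩

end Atoms

/-- A map that is injective on a finite set agrees there with some permutation. -/
theorem exists_perm_eqOn {α : Type*} {A : Set α} (hA : A.Finite) (f : α → α) (hf : A.InjOn f) :
    ∃ π : Equiv.Perm α, ∀ x ∈ A, π x = f x := by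
  classical
  induction A, hA using Set.Finite.induction_on with
  | empty => exact ⟨1, by simp⟩
  | @insert x A hx hA ih =>
    obtain ⟨π, hπ⟩ := ih (hf.mono (Set.subset_insert x A))
    -- The swap corrects the value at the new point; by injectivity neither swapped value is taken
    -- by `π` on `A`, so the old values survive.
    refine ⟨π.trans (Equiv.swap (π x) (f x)), ?_⟩
    intro y hy
    rcases hy with rfl | hy
    · simp
    · have hxy : y ≠ x := fun h => hx (h ▸ hy)
      have h₁ : π y ≠ π x := fun h => hxy (π.injective h)
      have h₂ : π y ≠ f x := fun h =>
        hxy (hf (Set.mem_insert_of_mem x hy) (Set.mem_insert x A) ((hπ y hy).symm.trans h))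
      rw [Equiv.trans_apply, Equiv.swap_apply_of_ne_of_ne h₁ h₂, hπ y hy]

/-- A finite set of variables can be renamed apart from another one. -/
theorem exists_perm_disjoint {A B : Set ℕ} (hA : A.Finite) (hB : B.Finite) :
    ∃ π : Equiv.Perm ℕ, ∀ x ∈ A, π x ∉ B := by
  obtain ⟨m, hm⟩ := hB.bddAbove
  obtain ⟨π, hπ⟩ := exists_perm_eqOn hA (fun x => x + (m + 1))
    fun x _ y _ h => by simpa using h
  refine ⟨π, fun x hx hx' => ?_⟩
  rw [hπ x hx] at hx'
  have := hm hx'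
  omega

variable {L : FirstOrder.Language.{u, v}} {Pr : Type w} {Nm : Type z}

/-! ### Identifiers -/

/-- Rename the variables and the identifier of an identified atom. -/
def IdAtom.act (π : Equiv.Perm Var) (ρ : Equiv.Perm ℕ) (h : IdAtom L Pr) : IdAtom L Pr :=
  (h.subst (varRenaming π)).mapId ρ

theorem IdAtom.act_act (π π' : Equiv.Perm Var) (ρ ρ' : Equiv.Perm ℕ) (h : IdAtom L Pr) :
    (h.act π ρ).act π' ρ' = h.act (π.trans π') (ρ.trans ρ') := by
  simp [IdAtom.act, IdAtom.subst, IdAtom.mapId, Atom.rename_rename]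

theorem IdAtom.act_one (h : IdAtom L Pr) : h.act 1 1 = h := by
  change (⟨h.atom.subst Term.var, h.id⟩ : IdAtom L Pr) = h
  rw [Atom.subst_var]

theorem Token.mapId_mapId (f g : ℕ → ℕ) (t : Token Nm) :
    (t.mapId f).mapId g = t.mapId (g ∘ f) := by
  simp [Token.mapId]

theorem Token.mapId_congr {f g : ℕ → ℕ} (t : Token Nm) (h : ∀ i ∈ t.ids, f i = g i) :
    t.mapId f = t.mapId g := by
  simp only [Token.mapId, Token.mk.injEq, true_and]
  exact List.map_congr_left h

theorem Token.mapId_id (t : Token Nm) : t.mapId id = t := by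
  cases t
  simp [Token.mapId]

theorem Token.mapId_injective {f : ℕ → ℕ} (hf : Function.Injective f) :
    Function.Injective (Token.mapId f : Token Nm → Token Nm) := by
  rintro ⟨n, l⟩ ⟨n', l'⟩ h
  simp only [Token.mapId, Token.mk.injEq] at h
  rw [h.1, List.map_injective_iff.2 hf h.2]

theorem idSet_add (A B : Multiset (IdAtom L Pr)) : idSet (A + B) = idSet A ∪ idSet B := by
  ext i
  simp only [idSet, Multiset.mem_add, Set.mem_ofPred_eq, Set.mem_union, or_and_right, exists_or]

theorem mem_idSet_map {A : Type*} (f : A → IdAtom L Pr) (B : Multiset A) (i : ℕ) :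
    i ∈ idSet (B.map f) ↔ ∃ h ∈ B, (f h).id = i := by
  simp [idSet]

theorem idSet_map_subst (θ : Var → L.Term Var) (B : Multiset (IdAtom L Pr)) :
    idSet (B.map (IdAtom.subst θ)) = idSet B := by
  ext i
  exact mem_idSet_map _ _ _

theorem finite_idSet (B : Multiset (IdAtom L Pr)) : (idSet B).Finite := by
  classical
  refine (Finset.finite_toSet (B.map IdAtom.id).toFinset).subset ?_
  rintro i ⟨h, hh, rfl⟩
  simpa using ⟨h, hh, rfl⟩

theorem mem_idSet_mapId (f : ℕ → ℕ) (B : Multiset (IdAtom L Pr)) (i : ℕ) :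
    i ∈ idSet (B.map (IdAtom.mapId f)) ↔ ∃ j ∈ idSet B, f j = i := by
  rw [mem_idSet_map]
  constructor
  · rintro ⟨h, hh, rfl⟩
    exact ⟨h.id, ⟨h, hh, rfl⟩, rfl⟩
  · rintro ⟨_, ⟨h, hh, rfl⟩, rfl⟩
    exact ⟨h, hh, rfl⟩

theorem mem_idSet_act (π : Equiv.Perm Var) (ρ : Equiv.Perm ℕ) (B : Multiset (IdAtom L Pr)) (i : ℕ) :
    i ∈ idSet (B.map (IdAtom.act π ρ)) ↔ ∃ j ∈ idSet B, ρ j = i := by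
  rw [mem_idSet_map]
  constructor
  · rintro ⟨h, hh, rfl⟩
    exact ⟨h.id, ⟨h, hh, rfl⟩, rfl⟩
  · rintro ⟨_, ⟨h, hh, rfl⟩, rfl⟩
    exact ⟨h, hh, rfl⟩

theorem maxId_map_subst (θ : Var → L.Term Var) (B : Multiset (IdAtom L Pr)) (T : Set (Token Nm)) :
    maxId (B.map (IdAtom.subst θ)) T = maxId B T := by
  simp only [maxId, idSet_map_subst]

/-- A supremum in `ℕ` bounds its set only if the set is bounded. Here token identifiers add nothing
to those of the finite body. -/
theorem le_maxId {B : Multiset (IdAtom L Pr)} {T : Set (Token Nm)} (hT : tokenIdSet T ⊆ idSet B)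
    {i : ℕ} (hi : i ∈ idSet B) : i ≤ maxId B T := by
  refine le_csSup ?_ (Or.inl hi)
  rw [Set.union_eq_left.2 hT]
  exact (finite_idSet B).bddAbove

/-! ### Renaming of rules -/

namespace Rule

theorem head_rename (π : Equiv.Perm Var) (r : Rule L Pr Nm) :
    (r.rename π).head = r.head.map (Atom.subst (varRenaming π)) := by
  simp [head, rename]

theorem mem_headFv_rename (π : Equiv.Perm Var) (r : Rule L Pr Nm) (x : Var) :
    x ∈ (r.rename π).headFv ↔ π.symm x ∈ r.headFv := by
  simp [headFv, head_rename, Atom.mem_fv_rename]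

theorem mem_fv_rename (π : Equiv.Perm Var) (r : Rule L Pr Nm) (x : Var) :
    x ∈ (r.rename π).fv ↔ π.symm x ∈ r.fv := by
  simp only [fv, Set.mem_union, mem_headFv_rename]
  simp [rename, Atom.mem_fv_rename, BuiltIn.mem_fv_rename, IdAtom.subst]

theorem apply_mem_fv_rename (π : Equiv.Perm Var) (r : Rule L Pr Nm) {x : Var} (hx : x ∈ r.fv) :
    π x ∈ (r.rename π).fv := by
  simpa [mem_fv_rename] using hx

theorem finite_fv (r : Rule L Pr Nm) : r.fv.Finite := by
  classical
  refine Set.Finite.union (Set.Finite.union (Set.Finite.union ?_ ?_) ?_) ?_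
  · exact ((List.finite_toSet r.head).biUnion fun (h : Atom L Pr) _ => h.finite_fv).subset
      fun _ ⟨t, ht, hx⟩ => Set.mem_biUnion ht hx
  · exact ((Multiset.finite_toSet r.guard).biUnion fun (h : BuiltIn L) _ => h.finite_fv).subset
      fun _ ⟨t, ht, hx⟩ => Set.mem_biUnion ht hx
  · exact ((Multiset.finite_toSet r.bodyChr).biUnion
      fun (h : IdAtom L Pr) _ => h.atom.finite_fv).subset
      fun _ ⟨t, ht, hx⟩ => Set.mem_biUnion ht hx
  · exact ((Multiset.finite_toSet r.bodyBuiltIn).biUnion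
      fun (h : BuiltIn L) _ => h.finite_fv).subset
      fun _ ⟨t, ht, hx⟩ => Set.mem_biUnion ht hx

theorem rename_rename (π τ : Equiv.Perm Var) (r : Rule L Pr Nm) :
    (r.rename π).rename τ = r.rename (π.trans τ) := by
  simp only [rename, List.map_map, Multiset.map_map, Rule.mk.injEq, true_and, and_true]
  refine ⟨?_, ?_, ?_, ?_, ?_⟩ <;> congr 1 <;> funext c
  · exact Atom.rename_rename _ _ c
  · exact Atom.rename_rename _ _ c
  · exact BuiltIn.rename_rename _ _ c
  · simp [IdAtom.subst, Atom.rename_rename]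
  · exact BuiltIn.rename_rename _ _ c

theorem WellFormed.rename {r : Rule L Pr Nm} (h : r.WellFormed) (π : Equiv.Perm Var) :
    (r.rename π).WellFormed where
  head_ne := by simpa [head_rename] using h.head_ne
  nodup := by
    have := h.nodup
    simpa [Rule.rename, IdAtom.subst, Multiset.map_map, Function.comp_def] using this
  pos := by
    intro a ha
    obtain ⟨b, hb, rfl⟩ := Multiset.mem_map.1 ha
    exact h.pos b hb
  tokens_sub := by
    change tokenIdSet r.tokens ⊆ idSet (r.bodyChr.map _)
    rw [idSet_map_subst]
    exact h.tokens_sub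

end Rule

/-! ### Applicability of a rule -/

/-- The pending built-in constraints and the built-in store hold. -/
def Config.Flat {M : Type*} [L.Structure M] (σ : Config L Pr Nm) (a : Var → M) : Prop :=
  (∀ c ∈ σ.pending, c.Holds a) ∧ σ.store.Holds a

open Classical in
/-- The stage reached by applying the rule variant `r` to the constraints `H₁ \ H₂`. -/
noncomputable def result (s : Stage L Pr Nm) (r : Rule L Pr Nm) (H₁ H₂ : List (IdAtom L Pr))
    (G : Multiset (IdAtom L Pr)) : Stage L Pr Nm :=
  ⟨s.used ∪ r.fv,
    ⟨r.bodyChr.map (IdAtom.mapId fun i => i + s.cfg.counter) + ↑H₁ + G,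
      r.bodyBuiltIn + s.cfg.pending,
      conj (equations (chr (H₁ ++ H₂)) r.head) s.cfg.store,
      s.cfg.tokens ∪ Token.mapId (fun i => i + s.cfg.counter) '' r.tokens ∪
        (if H₂ = [] then {⟨r.name, (H₁ ++ H₂).map IdAtom.id⟩} else ∅),
      s.cfg.counter + maxId r.bodyChr r.tokens⟩⟩

/-- The rule variant `r` can be applied to the constraints `H₁ \ H₂`, the other constraints being
`G`. -/
structure Applicable (CT : L.Theory) (s : Stage L Pr Nm) (r : Rule L Pr Nm)
    (H₁ H₂ : List (IdAtom L Pr)) (G : Multiset (IdAtom L Pr)) : Prop where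
  chrs : s.cfg.chrs = ↑H₁ + ↑H₂ + G
  nonfailed : ¬ s.cfg.Failed CT
  fresh : Disjoint r.fv s.used
  keep : Comparable (chr H₁) r.keep
  remove : Comparable (chr H₂) r.remove
  guard : ∀ (M : FirstOrder.Language.Theory.ModelType.{u, v, max u v} CT) (a : Var → M),
    s.cfg.store.Holds a → ∃ b : Var → M, (∀ y, y ∉ r.headFv → b y = a y) ∧
      (chr (H₁ ++ H₂)).map (Atom.eval b) = r.head.map (Atom.eval b) ∧ ∀ c ∈ r.guard, c.Holds b
  token : (⟨r.name, (H₁ ++ H₂).map IdAtom.id⟩ : Token Nm) ∉ s.cfg.tokens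

theorem comparable_append {H₁ H₂ : List (IdAtom L Pr)} {r : Rule L Pr Nm}
    (h₁ : Comparable (chr H₁) r.keep) (h₂ : Comparable (chr H₂) r.remove) :
    Comparable (chr (H₁ ++ H₂)) r.head := by
  unfold Comparable at *
  rw [chr, List.map_append]
  exact List.rel_append h₁ h₂

/-- Turns Apply' into a condition and a function of the chosen data: the equations become equalities
of values, and the successor is the explicit `result`. All later arguments about Apply' use this
form. -/
theorem applyStep_iff {CT : L.Theory} {P : Set (Rule L Pr Nm)} {s t : Stage L Pr Nm} :
    ApplyStep CT P s t ↔ ∃ r₀ ∈ P, ∃ (τ : Equiv.Perm Var) (H₁ H₂ : List (IdAtom L Pr))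
      (G : Multiset (IdAtom L Pr)), Applicable CT s (r₀.rename τ) H₁ H₂ G ∧
        t = result s (r₀.rename τ) H₁ H₂ G := by
  constructor
  · rintro ⟨U, H₁, H₂, G, Q, C, T, n, r₀, r, π, B', Tr, m, hfail, hr₀, hr, hfresh, hH₁, hH₂, hguard,
      htoken, hinst⟩
    subst hr
    simp only [inst, Prod.mk.injEq] at hinst
    obtain ⟨rfl, rfl, rfl⟩ := hinst
    refine ⟨r₀, hr₀, π, H₁, H₂, G, ⟨rfl, hfail, hfresh, hH₁, hH₂, ?_, htoken⟩, rfl⟩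
    intro M a ha
    obtain ⟨b, hb, hb'⟩ := hguard M a (by simpa using ha)
    refine ⟨b, hb, (forall_equations_holds_iff b (comparable_append hH₁ hH₂)).1 fun c hc => hb' c ?_,
      fun c hc => hb' c ?_⟩
    · simp [hc]
    · simp [hc]
  · rintro ⟨r₀, hr₀, τ, H₁, H₂, G, h, rfl⟩
    obtain ⟨U, ⟨S, Q, C, T, n⟩⟩ := s
    obtain ⟨rfl, hfail, hfresh, hH₁, hH₂, hguard, htoken⟩ := h
    refine ApplyStep.mk U H₁ H₂ G Q C T n r₀ _ τ _ _ _ hfail hr₀ rfl hfresh hH₁ hH₂ ?_ htoken rfl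
    intro M a ha
    obtain ⟨b, hb, hb₁, hb₂⟩ := hguard M a (by simpa using ha)
    refine ⟨b, hb, fun d hd => ?_⟩
    rcases Multiset.mem_add.1 hd with hd | hd
    · exact (forall_equations_holds_iff b (comparable_append hH₁ hH₂)).2 hb₁ d (by simpa using hd)
    · exact hb₂ d hd

theorem flat_result {M : Type*} [L.Structure M] {s : Stage L Pr Nm} {r : Rule L Pr Nm}
    {H₁ H₂ : List (IdAtom L Pr)} {G : Multiset (IdAtom L Pr)} (h₁ : Comparable (chr H₁) r.keep)
    (h₂ : Comparable (chr H₂) r.remove) (a : Var → M) :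
    (result s r H₁ H₂ G).cfg.Flat a ↔ (∀ c ∈ r.bodyBuiltIn, c.Holds a) ∧
      (chr (H₁ ++ H₂)).map (Atom.eval a) = r.head.map (Atom.eval a) ∧ s.cfg.Flat a := by
  simp only [Config.Flat, result, holds_conj, Multiset.mem_add, or_imp, forall_and,
    forall_equations_holds_iff a (comparable_append h₁ h₂)]
  tauto

/-! ### Invariants of derivations -/

/-- The invariants of the stages of a derivation from a configuration with free variables `V`. -/
structure Good (V : Set Var) (s : Stage L Pr Nm) : Prop where
  finite : s.used.Finite
  fv : s.cfg.fv ⊆ s.used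
  sub : V ⊆ s.used
  wf : s.cfg.WellFormed

theorem Config.finite_fv (σ : Config L Pr Nm) : σ.fv.Finite := by
  refine Set.Finite.union (Set.Finite.union ?_ ?_) σ.store.finite_fv
  · exact ((Multiset.finite_toSet σ.chrs).biUnion
      fun (h : IdAtom L Pr) _ => h.atom.finite_fv).subset
      fun _ ⟨t, ht, hx⟩ => Set.mem_biUnion ht hx
  · exact ((Multiset.finite_toSet σ.pending).biUnion
      fun (h : BuiltIn L) _ => h.finite_fv).subset
      fun _ ⟨t, ht, hx⟩ => Set.mem_biUnion ht hx

theorem good_start {σ : Config L Pr Nm} (h : σ.WellFormed) : Good σ.fv (Stage.start σ) :=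
  ⟨σ.finite_fv, subset_rfl, subset_rfl, h⟩

theorem Good.solve {CT : L.Theory} {V : Set Var} {s t : Stage L Pr Nm} (h : Good V s)
    (hst : SolveStep CT s t) : Good V t := by
  obtain ⟨U, S, c, G, C, C', T, n, -, -⟩ := hst
  refine ⟨h.finite.union C'.finite_fv, ?_, fun x hx => Or.inl (h.sub hx),
    ⟨h.wf.nodup, h.wf.ids_le, h.wf.tokens_le⟩⟩
  rintro x ((hx | ⟨d, hd, hx⟩) | hx)
  · exact Or.inl (h.fv (Or.inl (Or.inl hx)))
  · exact Or.inl (h.fv (Or.inl (Or.inr ⟨d, Multiset.mem_cons_of_mem hd, hx⟩)))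
  · exact Or.inr hx

/-- Body identifiers are positive and are shifted by the counter, so they exceed every identifier
used so far; this gives distinctness. The new counter still bounds them because tokens of a rule
mention only its body. -/
theorem Good.result {CT : L.Theory} {V : Set Var} {s : Stage L Pr Nm} (h : Good V s)
    {r : Rule L Pr Nm} (hr : r.WellFormed) {H₁ H₂ : List (IdAtom L Pr)}
    {G : Multiset (IdAtom L Pr)} (ha : Applicable CT s r H₁ H₂ G) :
    Good V (result s r H₁ H₂ G) := by
  have hids : ∀ i ∈ idSet (↑H₁ + G : Multiset (IdAtom L Pr)), i ∈ idSet s.cfg.chrs := by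
    rintro i ⟨k, hk, rfl⟩
    refine ⟨k, ?_, rfl⟩
    rw [ha.chrs]
    simp only [Multiset.mem_add] at hk ⊢
    tauto
  have hHid : ∀ i ∈ (H₁ ++ H₂).map IdAtom.id, i ≤ s.cfg.counter := by
    intro i hi
    obtain ⟨k, hk, rfl⟩ := List.mem_map.1 hi
    refine h.wf.ids_le _ ⟨k, ?_, rfl⟩
    rw [ha.chrs]
    simp only [Multiset.mem_add, Multiset.mem_coe]
    exact Or.inl (List.mem_append.1 hk)
  refine ⟨h.finite.union r.finite_fv, ?_, fun x hx => Or.inl (h.sub hx), ⟨?_, ?_, ?_⟩⟩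
  · rintro x ((⟨k, hk, hx⟩ | ⟨d, hd, hx⟩) | hx)
    · simp only [CHR.result, Multiset.mem_add, Multiset.mem_map, or_assoc] at hk
      rcases hk with ⟨k, hk, rfl⟩ | hk
      · exact Or.inr (Or.inl (Or.inr ⟨k, hk, hx⟩))
      · refine Or.inl (h.fv (Or.inl (Or.inl ⟨k, ?_, hx⟩)))
        rw [ha.chrs]
        simp only [Multiset.mem_add]
        tauto
    · rcases Multiset.mem_add.1 hd with hd | hd
      · exact Or.inr (Or.inr ⟨d, hd, hx⟩)
      · exact Or.inl (h.fv (Or.inl (Or.inr ⟨d, hd, hx⟩)))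
    · rcases (mem_fv_conj _ _ _).1 hx with ⟨c, hc, hx⟩ | hx
      · rcases fv_equations hc hx with ⟨k, hk, hx⟩ | ⟨k, hk, hx⟩
        · obtain ⟨k', hk', rfl⟩ := List.mem_map.1 hk
          refine Or.inl (h.fv (Or.inl (Or.inl ⟨k', ?_, hx⟩)))
          rw [ha.chrs]
          simp only [Multiset.mem_add, Multiset.mem_coe]
          exact Or.inl (List.mem_append.1 hk')
        · exact Or.inr (Or.inl (Or.inl (Or.inl ⟨k, hk, hx⟩)))
      · exact Or.inl (h.fv (Or.inr hx))
  · have h₁ := h.wf.nodup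
    rw [ha.chrs, add_right_comm, Multiset.map_add, Multiset.nodup_add] at h₁
    simp only [CHR.result]
    rw [add_assoc, Multiset.map_add, Multiset.nodup_add]
    refine ⟨?_, h₁.1, ?_⟩
    · rw [Multiset.map_map]
      have := hr.nodup.map (add_left_injective s.cfg.counter)
      rwa [Multiset.map_map] at this
    · rw [Multiset.disjoint_left]
      intro i hi hi'
      simp only [Multiset.mem_map] at hi hi'
      obtain ⟨k, ⟨k₀, hk₀, rfl⟩, rfl⟩ := hi
      obtain ⟨k', hk', e⟩ := hi'
      have h₂ := h.wf.ids_le _ (hids _ ⟨k', hk', rfl⟩)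
      have h₃ := hr.pos k₀ hk₀
      simp only [IdAtom.mapId] at e
      omega
  · intro i hi
    simp only [CHR.result] at hi ⊢
    rw [add_assoc, idSet_add] at hi
    rcases hi with hi | hi
    · obtain ⟨j, hj, rfl⟩ := (mem_idSet_mapId _ _ _).1 hi
      have := le_maxId hr.tokens_sub hj
      omega
    · have := h.wf.ids_le _ (hids i hi)
      omega
  · rintro i ⟨t, ht, hi⟩
    simp only [CHR.result] at ht ⊢
    rcases ht with (ht | ⟨t, ht, rfl⟩) | ht
    · have := h.wf.tokens_le i ⟨t, ht, hi⟩
      omega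
    · obtain ⟨j, hj, rfl⟩ := List.mem_map.1 hi
      have := le_maxId hr.tokens_sub (hr.tokens_sub ⟨t, ht, hj⟩)
      omega
    · split_ifs at ht
      · obtain rfl := ht
        have := hHid i hi
        omega
      · exact ht.elim

/-! ### Matching configurations -/

/-- Two configurations agree up to renaming of variables outside `V`, renaming of identifiers,
cleaning of the token store, and solving of built-in constraints. -/
structure Match (CT : L.Theory) (V : Set Var) (π : Equiv.Perm Var) (ρ : Equiv.Perm ℕ)
    (σ' σ : Config L Pr Nm) : Prop where
  fix : ∀ x ∈ V, π x = x
  chrs : σ'.chrs.map (IdAtom.act π ρ) = σ.chrs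
  flat : ∀ (M : FirstOrder.Language.Theory.ModelType.{u, v, max u v} CT) (a : Var → M),
    σ'.Flat (a ∘ π) ↔ σ.Flat a
  tokens : Token.mapId ρ '' clean σ'.chrs σ'.tokens = clean σ.chrs σ.tokens

theorem Config.flat_congr {M : Type*} [L.Structure M] (σ : Config L Pr Nm) {a b : Var → M}
    (h : ∀ x ∈ σ.fv, a x = b x) : σ.Flat a ↔ σ.Flat b := by
  refine and_congr (forall₂_congr fun c hc => c.holds_congr fun x hx => h x ?_)
    (σ.store.holds_congr fun x hx => h x (Or.inr hx))
  exact Or.inl (Or.inr ⟨c, hc, hx⟩)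

namespace Match

variable {CT : L.Theory} {V : Set Var} {π π' : Equiv.Perm Var} {ρ ρ' : Equiv.Perm ℕ}
  {σ σ' σ'' : Config L Pr Nm}

theorem refl (CT : L.Theory) (V : Set Var) (σ : Config L Pr Nm) : Match CT V 1 1 σ σ where
  fix _ _ := rfl
  chrs := by simp [funext IdAtom.act_one]
  flat _ _ := Iff.rfl
  tokens := by
    have : (Token.mapId (1 : Equiv.Perm ℕ) : Token Nm → Token Nm) = id := funext Token.mapId_id
    rw [this, Set.image_id]

theorem trans (h : Match CT V π ρ σ σ') (h' : Match CT V π' ρ' σ' σ'') :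
    Match CT V (π.trans π') (ρ.trans ρ') σ σ'' where
  fix x hx := by simp [h.fix x hx, h'.fix x hx]
  chrs := by
    rw [← h'.chrs, ← h.chrs, Multiset.map_map]
    congr 1
    funext k
    exact (IdAtom.act_act _ _ _ _ k).symm
  flat M a := (h.flat M (a ∘ π')).trans (h'.flat M a)
  tokens := by
    rw [← h'.tokens, ← h.tokens, Set.image_image]
    congr 1
    funext t
    exact (Token.mapId_mapId (⇑ρ) (⇑ρ') t).symm

theorem symm (h : Match CT V π ρ σ σ') : Match CT V π.symm ρ.symm σ' σ where
  fix x hx := by rw [Equiv.symm_apply_eq, h.fix x hx]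
  chrs := by
    rw [← h.chrs, Multiset.map_map]
    have : IdAtom.act π.symm ρ.symm ∘ IdAtom.act π ρ = (id : IdAtom L Pr → IdAtom L Pr) := by
      funext k
      simp only [Function.comp, IdAtom.act_act, Equiv.self_trans_symm]
      exact IdAtom.act_one k
    rw [this, Multiset.map_id]
  flat M a := by
    rw [← h.flat, Function.comp_assoc, Equiv.symm_comp_self, Function.comp_id]
  tokens := by
    rw [← h.tokens, Set.image_image]
    have : (fun t : Token Nm => (t.mapId ρ).mapId ρ.symm) = id := by
      funext t
      rw [Token.mapId_mapId, Equiv.symm_comp_self, Token.mapId_id]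
      rfl
    rw [this, Set.image_id]

/-- A match sees `π` only on `V` and the free variables, and `ρ` only on live identifiers, since
cleaning drops all other tokens. The renamings are thus free to be redefined on fresh names. -/
theorem congr (h : Match CT V π ρ σ σ') (hπ : ∀ x ∈ V ∪ σ.fv, π' x = π x)
    (hρ : ∀ i ∈ idSet σ.chrs, ρ' i = ρ i) : Match CT V π' ρ' σ σ' where
  fix x hx := (hπ x (Or.inl hx)).trans (h.fix x hx)
  chrs := by
    rw [← h.chrs]
    refine Multiset.map_congr rfl fun k hk => ?_
    simp only [IdAtom.act, IdAtom.subst, IdAtom.mapId, hρ _ ⟨k, hk, rfl⟩, IdAtom.mk.injEq,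
      and_true]
    refine Atom.subst_congr _ fun x hx => ?_
    simp only [varRenaming, hπ x (Or.inr (Or.inl (Or.inl ⟨k, hk, hx⟩)))]
  flat M a := by
    rw [← h.flat]
    exact σ.flat_congr fun x hx => congrArg a (hπ x (Or.inr hx))
  tokens := by
    rw [← h.tokens]
    exact Set.image_congr fun t ht => t.mapId_congr fun i hi => hρ i (ht.2 i hi)

end Match

theorem Config.failed_iff {CT : L.Theory} {σ : Config L Pr Nm} : σ.Failed CT ↔
    ∀ (M : FirstOrder.Language.Theory.ModelType.{u, v, max u v} CT) (a : Var → M),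
      ¬ σ.store.Holds a := by
  simp [Config.Failed, Satisfiable]

theorem Config.flat_of_pending {M : Type*} [L.Structure M] {σ : Config L Pr Nm}
    (h : σ.pending = 0) (a : Var → M) : σ.Flat a ↔ σ.store.Holds a := by
  simp [Config.Flat, h]

theorem Match.failed_iff {CT : L.Theory} {V : Set Var} {π : Equiv.Perm Var} {ρ : Equiv.Perm ℕ}
    {σ' σ : Config L Pr Nm} (h : Match CT V π ρ σ' σ) (hp' : σ'.pending = 0) (hp : σ.pending = 0) :
    σ'.Failed CT ↔ σ.Failed CT := by
  simp only [Config.failed_iff, ← Config.flat_of_pending hp', ← Config.flat_of_pending hp]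
  constructor
  · intro hf M a ha
    exact hf M _ ((h.flat M a).2 ha)
  · intro hf M a ha
    refine hf M (a ∘ π.symm) ((h.flat M _).1 ?_)
    rwa [Function.comp_assoc, Equiv.symm_comp_self, Function.comp_id]

/-- A surviving old token mentions only identifiers up to `n`, while the new constraints have
identifiers above `n`. So it was already alive before the step, and no dead token is revived by
reuse of an identifier. -/
theorem clean_result_subset {f : ℕ → ℕ} {A A' B X X' : Multiset (IdAtom L Pr)}
    {T T' Tr K K' : Set (Token Nm)} {n n' : ℕ} (hTr : tokenIdSet Tr ⊆ idSet B)
    (hpos : ∀ i ∈ idSet B, 0 < i) (h : Token.mapId f '' clean A T ⊆ clean A' T')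
    (hT : ∀ i ∈ tokenIdSet T, i ≤ n) (hX : idSet X ⊆ idSet A)
    (hXX : ∀ i ∈ idSet X, f i ∈ idSet X') (hB : ∀ i ∈ idSet B, f (i + n) = i + n')
    (hK : Token.mapId f '' K ⊆ K') :
    Token.mapId f '' clean (B.map (IdAtom.mapId fun i => i + n) + X)
        (T ∪ Token.mapId (fun i => i + n) '' Tr ∪ K) ⊆
      clean (B.map (IdAtom.mapId fun i => i + n') + X')
        (T' ∪ Token.mapId (fun i => i + n') '' Tr ∪ K') := by
  rintro _ ⟨t, ⟨ht, hti⟩, rfl⟩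
  refine ⟨?_, ?_⟩
  · rcases ht with (ht | ⟨t, ht, rfl⟩) | ht
    · refine Or.inl (Or.inl (h ⟨t, ⟨ht, fun i hi => ?_⟩, rfl⟩).1)
      have h₁ := hti i hi
      rw [idSet_add] at h₁
      rcases h₁ with h₁ | h₁
      · obtain ⟨j, hj, rfl⟩ := (mem_idSet_mapId _ _ _).1 h₁
        have h₂ : j + n ≤ n := hT _ ⟨t, ht, hi⟩
        have h₃ := hpos j hj
        omega
      · exact hX h₁
    · refine Or.inl (Or.inr ⟨t, ht, ?_⟩)
      rw [Token.mapId_mapId]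
      exact Token.mapId_congr t fun i hi => (hB i (hTr ⟨t, ht, hi⟩)).symm
    · exact Or.inr (hK ⟨t, ht, rfl⟩)
  · intro i hi
    obtain ⟨j, hj, rfl⟩ := List.mem_map.1 hi
    have h₁ := hti j hj
    rw [idSet_add] at h₁ ⊢
    rcases h₁ with h₁ | h₁
    · obtain ⟨k, hk, rfl⟩ := (mem_idSet_mapId _ _ _).1 h₁
      exact Or.inl ((mem_idSet_mapId _ _ _).2 ⟨k, hk, (hB k hk).symm⟩)
    · exact Or.inr (hXX j h₁)

theorem chr_act (π : Equiv.Perm Var) (ρ : Equiv.Perm ℕ) (H : List (IdAtom L Pr)) :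
    chr (H.map (IdAtom.act π ρ)) = (chr H).map (Atom.subst (varRenaming π)) := by
  simp only [chr, List.map_map]
  rfl

theorem ids_act (π : Equiv.Perm Var) (ρ : Equiv.Perm ℕ) (H : List (IdAtom L Pr)) :
    (H.map (IdAtom.act π ρ)).map IdAtom.id = (H.map IdAtom.id).map ρ := by
  simp only [List.map_map]
  rfl

theorem map_eval_rename {M : Type*} [L.Structure M] (a : Var → M) (π : Equiv.Perm Var)
    (H : List (Atom L Pr)) :
    (H.map (Atom.subst (varRenaming π))).map (Atom.eval a) = H.map (Atom.eval (a ∘ π)) := by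
  rw [List.map_map]
  congr 1
  funext h
  exact h.eval_subst a _

theorem map_eval_congr {M : Type*} [L.Structure M] {a b : Var → M} {H : List (Atom L Pr)}
    (h : ∀ x, (∃ k ∈ H, x ∈ k.fv) → a x = b x) : H.map (Atom.eval a) = H.map (Atom.eval b) :=
  List.map_congr_left fun k hk => k.eval_congr fun x hx => h x ⟨k, hk, hx⟩

/-! ### Transfer of rule applications between matching configurations. -/

section Transfer

variable {CT : L.Theory} {V : Set Var} {π : Equiv.Perm Var} {ρ : Equiv.Perm ℕ}
  {s' s : Stage L Pr Nm} {r₀ : Rule L Pr Nm} {τ τ₂ : Equiv.Perm Var} {H₁ H₂ : List (IdAtom L Pr)}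
  {G : Multiset (IdAtom L Pr)}

/-- Matching configurations allow the same rule applications. -/
theorem Applicable.transfer (hm : Match CT V π ρ s'.cfg s.cfg)
    (hp' : s'.cfg.pending = 0) (hp : s.cfg.pending = 0)
    (ha : Applicable CT s' (r₀.rename τ) H₁ H₂ G) (hτ : ∀ x ∈ r₀.fv, π (τ x) = τ₂ x)
    (hτ₂ : ∀ x ∈ r₀.fv, τ₂ x ∉ s.used) :
    Applicable CT s (r₀.rename τ₂) (H₁.map (IdAtom.act π ρ)) (H₂.map (IdAtom.act π ρ))
      (G.map (IdAtom.act π ρ)) where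
  chrs := by
    rw [← hm.chrs, ha.chrs]
    simp
  nonfailed := fun h => ha.nonfailed ((hm.failed_iff hp' hp).2 h)
  fresh := by
    rw [Set.disjoint_left]
    intro x hx hx'
    refine hτ₂ _ ((Rule.mem_fv_rename τ₂ r₀ x).1 hx) ?_
    simpa using hx'
  keep := by
    rw [chr_act]
    have := (comparable_subst_right_iff (varRenaming τ)).1 ha.keep
    exact (comparable_subst_iff _ _).2 this
  remove := by
    rw [chr_act]
    have := (comparable_subst_right_iff (varRenaming τ)).1 ha.remove
    exact (comparable_subst_iff _ _).2 this
  guard := by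
    intro M a hC
    obtain ⟨b, hb, hb₁, hb₂⟩ := ha.guard M (a ∘ π)
      ((Config.flat_of_pending hp' _).1 ((hm.flat M a).2 ((Config.flat_of_pending hp a).2 hC)))
    have hagree : ∀ x ∈ r₀.fv, ((b ∘ π.symm) ∘ τ₂) x = (b ∘ τ) x := by
      intro x hx
      simp [← hτ x hx]
    have hsub : r₀.headFv ⊆ r₀.fv := fun x hx => Or.inl (Or.inl (Or.inl hx))
    -- The witness for `s'` is carried along `π`; on the variables of the rule it gives the same
    -- values, because `τ₂` is `π` after `τ` there.
    refine ⟨b ∘ π.symm, ?_, ?_, ?_⟩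
    · intro y hy
      rw [Function.comp_apply, hb, Function.comp_apply, Equiv.apply_symm_apply]
      rw [Rule.mem_headFv_rename] at hy ⊢
      intro hx
      apply hy
      have := hτ _ (hsub hx)
      rw [Equiv.apply_symm_apply, Equiv.apply_symm_apply] at this
      rwa [this, Equiv.symm_apply_apply]
    · rw [← List.map_append, chr_act, map_eval_rename, Function.comp_assoc, Equiv.symm_comp_self,
        Function.comp_id, hb₁, Rule.head_rename, Rule.head_rename, map_eval_rename, map_eval_rename]
      exact (map_eval_congr fun x hx => hagree x (hsub hx)).symm
    · intro c hc
      obtain ⟨d, hd, rfl⟩ := Multiset.mem_map.1 hc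
      have := hb₂ _ (Multiset.mem_map_of_mem _ hd)
      rw [BuiltIn.holds_rename] at this ⊢
      exact (d.holds_congr fun x hx => hagree x (Or.inl (Or.inl (Or.inr ⟨d, hd, hx⟩)))).2 this
  token := by
    intro h
    rw [← List.map_append, ids_act] at h
    -- This token mentions only constraints that are present, so cleaning keeps it and the agreement
    -- of the cleaned stores applies.
    have : (⟨r₀.name, ((H₁ ++ H₂).map IdAtom.id).map ρ⟩ : Token Nm) ∈ clean s.cfg.chrs s.cfg.tokens := by
      refine ⟨h, fun i hi => ?_⟩
      obtain ⟨j, hj, rfl⟩ := List.mem_map.1 hi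
      obtain ⟨k, hk, rfl⟩ := List.mem_map.1 hj
      rw [← hm.chrs, mem_idSet_act]
      refine ⟨_, ⟨k, ?_, rfl⟩, rfl⟩
      rw [ha.chrs]
      simp only [Multiset.mem_add, Multiset.mem_coe]
      exact Or.inl (List.mem_append.1 hk)
    rw [← hm.tokens] at this
    obtain ⟨t, ht, e⟩ := this
    have e' : t = ⟨r₀.name, (H₁ ++ H₂).map IdAtom.id⟩ := Token.mapId_injective ρ.injective e
    exact ha.token (e' ▸ ht.1)

theorem clean_result_transfer (hg' : Good V s') (hm : Match CT V π ρ s'.cfg s.cfg)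
    (ha : Applicable CT s' (r₀.rename τ) H₁ H₂ G)
    (hρ : ∀ i ∈ idSet r₀.bodyChr, ρ (i + s'.cfg.counter) = i + s.cfg.counter)
    (hr : r₀.WellFormed) :
    Token.mapId ρ '' clean (result s' (r₀.rename τ) H₁ H₂ G).cfg.chrs
        (result s' (r₀.rename τ) H₁ H₂ G).cfg.tokens ⊆
      clean (result s (r₀.rename τ₂) (H₁.map (IdAtom.act π ρ)) (H₂.map (IdAtom.act π ρ))
        (G.map (IdAtom.act π ρ))).cfg.chrs
        (result s (r₀.rename τ₂) (H₁.map (IdAtom.act π ρ)) (H₂.map (IdAtom.act π ρ))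
        (G.map (IdAtom.act π ρ))).cfg.tokens := by
  -- Renaming variables changes no identifier, so `clean` does not see it.
  have e : ∀ (n : ℕ) (τ : Equiv.Perm Var) (X : Multiset (IdAtom L Pr)) (T : Set (Token Nm)),
      clean ((r₀.rename τ).bodyChr.map (IdAtom.mapId fun i => i + n) + X) T =
        clean (r₀.bodyChr.map (IdAtom.mapId fun i => i + n) + X) T := by
    intro n τ X T
    have : idSet ((r₀.rename τ).bodyChr.map (IdAtom.mapId fun i => i + n)) =
        idSet (r₀.bodyChr.map (IdAtom.mapId fun i => i + n)) := by
      ext i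
      rw [mem_idSet_mapId, mem_idSet_mapId]
      change (∃ j ∈ idSet (r₀.bodyChr.map (IdAtom.subst _)), _) ↔ _
      rw [idSet_map_subst]
    simp only [clean, idSet_add, this]
  simp only [result, add_assoc]
  rw [e, e]
  refine clean_result_subset hr.tokens_sub ?_ hm.tokens.subset hg'.wf.tokens_le ?_ ?_ hρ ?_
  · rintro i ⟨k, hk, rfl⟩
    exact hr.pos k hk
  · rw [ha.chrs]
    simp only [idSet_add]
    rintro i (hi | hi)
    · exact Or.inl (Or.inl hi)
    · exact Or.inr hi
  · intro i hi
    have : (↑(H₁.map (IdAtom.act π ρ)) + G.map (IdAtom.act π ρ) : Multiset (IdAtom L Pr)) =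
        (↑H₁ + G : Multiset (IdAtom L Pr)).map (IdAtom.act π ρ) := by simp
    rw [this, mem_idSet_act]
    exact ⟨i, hi, rfl⟩
  · by_cases h : H₂ = []
    · subst h
      rintro _ ⟨t, ht, rfl⟩
      simp only [if_true, List.append_nil, List.map_nil, Set.mem_singleton_iff] at ht ⊢
      rw [ht, ids_act]
      rfl
    · simp [h]

theorem Match.result (hg' : Good V s') (hm : Match CT V π ρ s'.cfg s.cfg)
    (hg : Good V s) (hp' : s'.cfg.pending = 0) (hp : s.cfg.pending = 0)
    (ha : Applicable CT s' (r₀.rename τ) H₁ H₂ G) (hτ : ∀ x ∈ r₀.fv, π (τ x) = τ₂ x)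
    (hτ₂ : ∀ x ∈ r₀.fv, τ₂ x ∉ s.used)
    (hρ : ∀ i ∈ idSet r₀.bodyChr, ρ (i + s'.cfg.counter) = i + s.cfg.counter)
    (hr : r₀.WellFormed) :
    Match CT V π ρ (result s' (r₀.rename τ) H₁ H₂ G).cfg
      (result s (r₀.rename τ₂) (H₁.map (IdAtom.act π ρ)) (H₂.map (IdAtom.act π ρ))
        (G.map (IdAtom.act π ρ))).cfg := by
  have ha₂ := ha.transfer hm hp' hp hτ hτ₂
  refine ⟨hm.fix, ?_, ?_, ?_⟩
  · simp only [CHR.result, Multiset.map_add, Multiset.map_coe, Multiset.map_map, Rule.rename]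
    congr 2
    refine Multiset.map_congr rfl fun k hk => ?_
    simp only [IdAtom.act, Function.comp, IdAtom.subst, IdAtom.mapId, IdAtom.mk.injEq,
      hρ _ ⟨k, hk, rfl⟩, Atom.rename_rename, and_true]
    refine Atom.subst_congr _ fun x hx => ?_
    have := hτ x (Or.inl (Or.inr ⟨k, hk, hx⟩))
    simp [varRenaming, this]
  · intro M a
    have hagree : ∀ x ∈ r₀.fv, ((a ∘ π) ∘ τ) x = (a ∘ τ₂) x := fun x hx => congrArg a (hτ x hx)
    rw [flat_result ha.keep ha.remove, flat_result ha₂.keep ha₂.remove, hm.flat]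
    refine and_congr ?_ (and_congr ?_ Iff.rfl)
    · simp only [Rule.rename, Multiset.mem_map, forall_exists_index, and_imp,
        forall_apply_eq_imp_iff₂, BuiltIn.holds_rename]
      exact forall₂_congr fun c hc => c.holds_congr fun x hx => hagree x (Or.inr ⟨c, hc, hx⟩)
    · rw [← List.map_append, chr_act, map_eval_rename, Rule.head_rename, Rule.head_rename,
        map_eval_rename, map_eval_rename,
        map_eval_congr fun x hx => hagree x (Or.inl (Or.inl (Or.inl hx)))]
  -- The reverse inclusion is the same lemma for the inverse match, which sends the transferred
  -- application back to the original one.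
  · refine (clean_result_transfer hg' hm ha hρ hr).antisymm ?_
    have hρ' : ∀ i ∈ idSet r₀.bodyChr, ρ.symm (i + s.cfg.counter) = i + s'.cfg.counter :=
      fun i hi => by rw [Equiv.symm_apply_eq, hρ i hi]
    have h := clean_result_transfer (τ₂ := τ) hg hm.symm ha₂ hρ' hr
    have e : ∀ H : List (IdAtom L Pr),
        (H.map (IdAtom.act π ρ)).map (IdAtom.act π.symm ρ.symm) = H := by
      intro H
      rw [List.map_map]
      refine (List.map_congr_left fun k _ => ?_).trans (List.map_id H)
      simp only [Function.comp, IdAtom.act_act, Equiv.self_trans_symm]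
      exact IdAtom.act_one k
    have e' : (G.map (IdAtom.act π ρ)).map (IdAtom.act π.symm ρ.symm) = G := by
      obtain ⟨G⟩ := G
      exact congrArg (fun l : List (IdAtom L Pr) => (l : Multiset (IdAtom L Pr))) (e G)
    rw [e, e, e'] at h
    intro t ht
    refine ⟨t.mapId ρ.symm, h ⟨t, ht, rfl⟩, ?_⟩
    rw [Token.mapId_mapId, Equiv.self_comp_symm, Token.mapId_id]

/-- A rule application can be repeated in a matching configuration, and any finite set of variables
can be made fresh in the process. -/
theorem exists_transfer {F : Set Var} (hg' : Good V s') (hg : Good V s)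
    (hm : Match CT V π ρ s'.cfg s.cfg) (hp' : s'.cfg.pending = 0) (hp : s.cfg.pending = 0)
    (hr : r₀.WellFormed) (ha : Applicable CT s' (r₀.rename τ) H₁ H₂ G) (hF : F.Finite) :
    ∃ (τ₂ : Equiv.Perm Var) (H₁' H₂' : List (IdAtom L Pr)) (G' : Multiset (IdAtom L Pr)),
      (∀ x ∈ F, τ₂ x ∉ s.used) ∧ Applicable CT s (r₀.rename τ₂) H₁' H₂' G' ∧
      ∃ π' ρ', Match CT V π' ρ' (result s' (r₀.rename τ) H₁ H₂ G).cfg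
        (result s (r₀.rename τ₂) H₁' H₂' G').cfg := by
  classical
  -- Avoiding the image of `s'.used` under `π`, besides `s.used`, is what makes the map glued below
  -- injective.
  obtain ⟨τ₂, hτ₂⟩ := exists_perm_disjoint (hF.union r₀.finite_fv)
    (hg.finite.union (hg'.finite.image π))
  have hfresh : ∀ x ∈ r₀.fv, τ x ∉ s'.used := fun x hx =>
    Set.disjoint_left.1 ha.fresh (r₀.apply_mem_fv_rename τ hx)
  -- Variables used before keep their image under `π`; the fresh variables of one rule variant go to
  -- those of the other.
  obtain ⟨π', hπ'⟩ := exists_perm_eqOn (hg'.finite.union (r₀.finite_fv.image τ))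
    (fun x => if x ∈ s'.used then π x else τ₂ (τ.symm x)) (by
      have key : ∀ x ∈ s'.used, ∀ y ∈ r₀.fv, π x ≠ τ₂ y := fun x hx y hy h =>
        hτ₂ y (Or.inr hy) (Or.inr ⟨x, hx, h⟩)
      rintro x (hx | ⟨x, hx, rfl⟩) y (hy | ⟨y, hy, rfl⟩) h
      · simpa [hx, hy] using h
      · simp only [hx, hfresh y hy, if_true, if_false, Equiv.symm_apply_apply] at h
        exact (key x hx y hy h).elim
      · simp only [hy, hfresh x hx, if_true, if_false, Equiv.symm_apply_apply] at h
        exact (key y hy x hx h.symm).elim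
      · simpa [hfresh x hx, hfresh y hy] using h)
  have hρmem : ∀ i ∈ idSet s'.cfg.chrs, ρ i ≤ s.cfg.counter := fun i hi =>
    hg.wf.ids_le _ (by rw [← hm.chrs, mem_idSet_act]; exact ⟨i, hi, rfl⟩)
  have hpos : ∀ i ∈ idSet r₀.bodyChr, 0 < i := by
    rintro i ⟨k, hk, rfl⟩
    exact hr.pos k hk
  -- Identifiers up to the counter are old and follow `ρ`; those above it come from the rule body,
  -- and their offset changes from one counter to the other.
  obtain ⟨ρ', hρ'⟩ := exists_perm_eqOn ((finite_idSet s'.cfg.chrs).union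
    ((finite_idSet r₀.bodyChr).image fun i => i + s'.cfg.counter))
    (fun i => if i ≤ s'.cfg.counter then ρ i else i - s'.cfg.counter + s.cfg.counter) (by
      have key : ∀ i ∈ idSet r₀.bodyChr, ¬ i + s'.cfg.counter ≤ s'.cfg.counter := fun i hi h => by
        have := hpos i hi
        omega
      rintro x (hx | ⟨x, hx, rfl⟩) y (hy | ⟨y, hy, rfl⟩) h
      · simpa [hg'.wf.ids_le x hx, hg'.wf.ids_le y hy] using h
      · simp only [hg'.wf.ids_le x hx, key y hy, if_true, if_false, Nat.add_sub_cancel] at h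
        have h₁ := hρmem x hx
        have h₂ := hpos y hy
        omega
      · simp only [hg'.wf.ids_le y hy, key x hx, if_true, if_false, Nat.add_sub_cancel] at h
        have h₁ := hρmem y hy
        have h₂ := hpos x hx
        omega
      · simp only [key x hx, key y hy, if_false, Nat.add_sub_cancel] at h
        simp only
        omega)
  have hm' : Match CT V π' ρ' s'.cfg s.cfg := by
    refine hm.congr ?_ ?_
    · intro x hx
      have hx' : x ∈ s'.used := hx.elim (fun h => hg'.sub h) (fun h => hg'.fv h)
      rw [hπ' x (Or.inl hx'), if_pos hx']
    · intro i hi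
      rw [hρ' i (Or.inl hi), if_pos (hg'.wf.ids_le i hi)]
  have hτ : ∀ x ∈ r₀.fv, π' (τ x) = τ₂ x := fun x hx => by
    rw [hπ' _ (Or.inr ⟨x, hx, rfl⟩), if_neg (hfresh x hx), Equiv.symm_apply_apply]
  have hρ : ∀ i ∈ idSet r₀.bodyChr, ρ' (i + s'.cfg.counter) = i + s.cfg.counter := fun i hi => by
    have := hpos i hi
    rw [hρ' _ (Or.inr ⟨i, hi, rfl⟩), if_neg (show ¬ i + s'.cfg.counter ≤ s'.cfg.counter by omega),
      Nat.add_sub_cancel]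
  have hτ₂' : ∀ x ∈ r₀.fv, τ₂ x ∉ s.used := fun x hx h => hτ₂ x (Or.inr hx) (Or.inl h)
  exact ⟨τ₂, _, _, _, fun x hx h => hτ₂ x (Or.inl hx) (Or.inl h),
    ha.transfer hm' hp' hp hτ hτ₂', π', ρ',
    Match.result hg' hm' hg hp' hp ha hτ hτ₂' hρ hr⟩

end Transfer

/-! ### Solving all pending built-in constraints -/

/-- The stage `t` is `s` after its pending built-in constraints have been solved, as far as this is
possible without failure. -/
structure Solved (CT : L.Theory) (s t : Stage L Pr Nm) : Prop where
  used : t.used = s.used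
  chrs : t.cfg.chrs = s.cfg.chrs
  tokens : t.cfg.tokens = s.cfg.tokens
  counter : t.cfg.counter = s.cfg.counter
  flat : (t.cfg.Failed CT ∧ ∀ (M : FirstOrder.Language.Theory.ModelType.{u, v, max u v} CT)
      (a : Var → M), ¬ s.cfg.Flat a) ∨
    (¬ t.cfg.Failed CT ∧ t.cfg.pending = 0 ∧
      ∀ (M : FirstOrder.Language.Theory.ModelType.{u, v, max u v} CT) (a : Var → M),
        s.cfg.Flat a ↔ t.cfg.Flat a)

/-- Solving may fail midway and then has to stop, whence the alternative in `Solved`. A failed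
intermediate store is part of the whole conjunction, which is then inconsistent. -/
theorem exists_solved (CT : L.Theory) (s : Stage L Pr Nm) (hs : s.cfg.fv ⊆ s.used) :
    ∃ t, Relation.ReflTransGen (SolveStep CT) s t ∧ Solved CT s t := by
  obtain ⟨U, S, Q, C, T, n⟩ := s
  induction Q using Multiset.induction_on generalizing C with
  | empty =>
    refine ⟨_, .refl, rfl, rfl, rfl, rfl, ?_⟩
    by_cases h : (⟨S, 0, C, T, n⟩ : Config L Pr Nm).Failed CT
    · exact Or.inl ⟨h, fun M a ha => Config.failed_iff.1 h M a ha.2⟩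
    · exact Or.inr ⟨h, rfl, fun _ _ => Iff.rfl⟩
  | cons c Q ih =>
    by_cases h : (⟨S, c ::ₘ Q, C, T, n⟩ : Config L Pr Nm).Failed CT
    · exact ⟨_, .refl, rfl, rfl, rfl, rfl, Or.inl ⟨h, fun M a ha => Config.failed_iff.1 h M a ha.2⟩⟩
    -- Among the equivalent stores that Solve' allows, the literal conjunction brings in no new
    -- variable, so the set of used variables stays the same.
    · have hstep := SolveStep.mk (CT := CT) U S c Q C (c.and C) T n h ⟨fun _ _ h => h, fun _ _ h => h⟩
      have hsub : (c.and C).fv ⊆ U := by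
        rw [BuiltIn.fv_and]
        rintro x (hx | hx)
        · exact hs (Or.inl (Or.inr ⟨c, by simp, hx⟩))
        · exact hs (Or.inr hx)
      rw [Set.union_eq_left.2 hsub] at hstep
      obtain ⟨t, ht, h₁, h₂, h₃, h₄, h₅⟩ := ih (c.and C) (by
        rintro x ((hx | ⟨d, hd, hx⟩) | hx)
        · exact hs (Or.inl (Or.inl hx))
        · exact hs (Or.inl (Or.inr ⟨d, Multiset.mem_cons_of_mem hd, hx⟩))
        · exact hsub hx)
      refine ⟨t, .head hstep ht, h₁, h₂, h₃, h₄, ?_⟩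
      have e : ∀ (M : FirstOrder.Language.Theory.ModelType.{u, v, max u v} CT) (a : Var → M),
          (⟨S, c ::ₘ Q, C, T, n⟩ : Config L Pr Nm).Flat a ↔
            (⟨S, Q, c.and C, T, n⟩ : Config L Pr Nm).Flat a := by
        intro M a
        simp only [Config.Flat, Multiset.mem_cons, forall_eq_or_imp, BuiltIn.holds_and]
        tauto
      simpa only [e] using h₅

theorem Good.solves {CT : L.Theory} {V : Set Var} {s t : Stage L Pr Nm} (h : Good V s)
    (hst : Relation.ReflTransGen (SolveStep CT) s t) : Good V t := by
  induction hst with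
  | refl => exact h
  | tail _ hst ih => exact ih.solve hst

/-- The stage `s` simulates `s'`: both lead to failure, or `s` has no pending built-in constraint
and the configurations match. -/
def Simulates (CT : L.Theory) (V : Set Var) (s' s : Stage L Pr Nm) : Prop :=
  (s.cfg.Failed CT ∧ ∀ (M : FirstOrder.Language.Theory.ModelType.{u, v, max u v} CT)
    (a : Var → M), ¬ s'.cfg.Flat a) ∨
  (s.cfg.pending = 0 ∧ ∃ π ρ, Match CT V π ρ s'.cfg s.cfg)

theorem Match.of_eq {CT : L.Theory} (V : Set Var) {σ' σ : Config L Pr Nm}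
    (hchrs : σ'.chrs = σ.chrs)
    (hflat : ∀ (M : FirstOrder.Language.Theory.ModelType.{u, v, max u v} CT) (a : Var → M),
      σ'.Flat a ↔ σ.Flat a)
    (htokens : clean σ'.chrs σ'.tokens = clean σ.chrs σ.tokens) : Match CT V 1 1 σ' σ := by
  have h := Match.refl CT V σ'
  exact ⟨h.fix, h.chrs.trans hchrs, fun M a => (h.flat M a).trans (hflat M a),
    h.tokens.trans htokens⟩

theorem Solved.simulates {CT : L.Theory} {s t : Stage L Pr Nm} (h : Solved CT s t) (V : Set Var) :
    Simulates CT V s t := by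
  rcases h.flat with h' | ⟨-, h₁, h₂⟩
  · exact Or.inl h'
  · exact Or.inr ⟨h₁, 1, 1, .of_eq V h.chrs.symm h₂ (by rw [h.chrs, h.tokens])⟩

theorem Match.flat_unsat {CT : L.Theory} {V : Set Var} {π : Equiv.Perm Var} {ρ : Equiv.Perm ℕ}
    {σ' σ : Config L Pr Nm} (h : Match CT V π ρ σ' σ)
    (hσ : ∀ (M : FirstOrder.Language.Theory.ModelType.{u, v, max u v} CT) (a : Var → M),
      ¬ σ.Flat a) (M : FirstOrder.Language.Theory.ModelType.{u, v, max u v} CT) (a : Var → M) :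
    ¬ σ'.Flat a := by
  intro ha
  refine hσ M (a ∘ π.symm) ((h.flat M _).1 ?_)
  rwa [Function.comp_assoc, Equiv.symm_comp_self, Function.comp_id]

theorem Match.simulates {CT : L.Theory} {V : Set Var} {π : Equiv.Perm Var} {ρ : Equiv.Perm ℕ}
    {s'' s' s : Stage L Pr Nm} (hm : Match CT V π ρ s''.cfg s'.cfg) (h : Simulates CT V s' s) :
    Simulates CT V s'' s := by
  rcases h with ⟨h₁, h₂⟩ | ⟨h₁, π', ρ', hm'⟩
  · exact Or.inl ⟨h₁, hm.flat_unsat h₂⟩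
  · exact Or.inr ⟨h₁, _, _, hm.trans hm'⟩

/-- The basic move of the simulating derivation: an Apply' followed at once by Solve' steps. That it
takes at least one step is what termination relies on. -/
theorem apply_solve {CT : L.Theory} {P : Set (Rule L Pr Nm)} {V : Set Var} {s : Stage L Pr Nm}
    (hg : Good V s) (hp : s.cfg.pending = 0) {r₀ : Rule L Pr Nm} (hr₀ : r₀ ∈ P)
    (hr : r₀.WellFormed) {τ : Equiv.Perm Var} {H₁ H₂ : List (IdAtom L Pr)}
    {G : Multiset (IdAtom L Pr)} (ha : Applicable CT s (r₀.rename τ) H₁ H₂ G) :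
    ∃ t, Relation.TransGen (NormalStep CT P) s t ∧ Good V t ∧
      Solved CT (result s (r₀.rename τ) H₁ H₂ G) t := by
  have hg₁ := hg.result (hr.rename τ) ha
  obtain ⟨t, ht, h⟩ := exists_solved CT _ hg₁.fv
  refine ⟨t, Relation.TransGen.head' ?_ (Relation.ReflTransGen.mono (fun _ _ => Or.inl) _ _ ht),
    hg₁.solves ht, h⟩
  exact Or.inr ⟨Or.inr hp, applyStep_iff.2 ⟨r₀, hr₀, τ, H₁, H₂, G, ha, rfl⟩⟩

/-! ### Applying an unfolded rule -/

/-- The matched constraints contain no head variable of the fresh variant, so they have the same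
values under `a` and `b`. Hence so does the head, and injectivity of function symbols descends from
the atoms to their variables. An existential witness for the guard is thereby the actual assignment.
-/
theorem Applicable.eq_of_holds {CT : L.Theory} (hCT : ClarkEquality CT) {V : Set Var}
    {s : Stage L Pr Nm} (hg : Good V s) {r : Rule L Pr Nm} {H₁ H₂ : List (IdAtom L Pr)}
    {G : Multiset (IdAtom L Pr)} (ha : Applicable CT s r H₁ H₂ G)
    (M : FirstOrder.Language.Theory.ModelType.{u, v, max u v} CT) {a b : Var → M}
    (hb : ∀ y, y ∉ r.headFv → b y = a y)
    (h₁ : (chr (H₁ ++ H₂)).map (Atom.eval a) = r.head.map (Atom.eval a))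
    (h₂ : (chr (H₁ ++ H₂)).map (Atom.eval b) = r.head.map (Atom.eval b)) : b = a := by
  funext x
  by_cases hx : x ∈ r.headFv
  · have h₃ : (chr (H₁ ++ H₂)).map (Atom.eval b) = (chr (H₁ ++ H₂)).map (Atom.eval a) := by
      refine map_eval_congr fun y hy => hb y fun hy' => ?_
      obtain ⟨k, hk, hy⟩ := hy
      obtain ⟨k', hk', rfl⟩ := List.mem_map.1 hk
      refine Set.disjoint_left.1 ha.fresh (Or.inl (Or.inl (Or.inl hy'))) (hg.fv ?_)
      refine Or.inl (Or.inl ⟨k', ?_, hy⟩)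
      rw [ha.chrs]
      simp only [Multiset.mem_add, Multiset.mem_coe]
      exact Or.inl (List.mem_append.1 hk')
    rw [h₁, h₂] at h₃
    obtain ⟨k, hk, hx⟩ := hx
    exact hCT.eq_of_eval_eq M k (List.map_inj_left.1 h₃ k hk) x hx
  · exact hb x hx

/-- One application of the unfolding is replayed as r, then v. The set `F` holds the variables that
must be fresh for this: guard constraints of v that are already entailed are dropped, so their
variables need not occur in the unfolding and its own freshness does not cover them. -/
theorem IsUnfolding.exists_simulation {CT : L.Theory} (hCT : ClarkEquality CT)
    {P : Set (Rule L Pr Nm)} {r v₀ r' : Rule L Pr Nm} (hr : r ∈ P) (hv₀ : v₀ ∈ P)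
    (hrw : r.WellFormed) (hvw : v₀.WellFormed) (h : IsUnfolding CT r v₀ r') :
    ∃ F : Set Var, F.Finite ∧ ∀ (V : Set Var) (s : Stage L Pr Nm) (τ : Equiv.Perm Var)
      (H₁ H₂ : List (IdAtom L Pr)) (G : Multiset (IdAtom L Pr)), Good V s → s.cfg.pending = 0 →
      Applicable CT s (r'.rename τ) H₁ H₂ G → (∀ x ∈ F, τ x ∉ s.used) →
      ∃ t, Relation.TransGen (NormalStep CT P) s t ∧ Good V t ∧
        Simulates CT V (result s (r'.rename τ) H₁ H₂ G) t := by
  classical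
  obtain ⟨v, π₀, K, S₁, S₂, θ, D'', B₁, T₁, m₁, hv, happart, hbody, hS₁, hS₂, hθ, hmatch, htoken,
    hD'', -, hinst⟩ := h
  have hvw' : v.WellFormed := hv ▸ hvw.rename π₀
  simp only [inst, Prod.mk.injEq] at hinst
  obtain ⟨rfl, rfl, rfl⟩ := hinst
  refine ⟨r.fv ∪ v.fv, r.finite_fv.union v.finite_fv, ?_⟩
  intro V s τ H₁ H₂ G hg hp ha hF
  set r' : Rule L Pr Nm := _
  change Applicable CT s (r'.rename τ) H₁ H₂ G at ha
  have hr'guard : (r'.rename τ).guard = (r.rename τ).guard +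
      (D''.map (BuiltIn.subst θ)).map (BuiltIn.subst (varRenaming τ)) :=
    Multiset.map_add _ _ _
  -- the original rule applies
  have ha₁ : Applicable CT s (r.rename τ) H₁ H₂ G := by
    refine ⟨ha.chrs, ha.nonfailed, ?_, ha.keep, ha.remove, ?_, ha.token⟩
    · rw [Set.disjoint_left]
      intro x hx hx'
      refine hF _ (Or.inl ((Rule.mem_fv_rename τ r x).1 hx)) ?_
      simpa using hx'
    · intro M a hC
      obtain ⟨b, hb, hb₁, hb₂⟩ := ha.guard M a hC
      refine ⟨b, hb, hb₁, fun c hc => hb₂ c ?_⟩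
      rw [hr'guard]
      exact Multiset.mem_add.2 (Or.inl hc)
  obtain ⟨s₂, hs₂, hg₂, hsol⟩ := apply_solve hg hp hr hrw ha₁
  -- The unfolded body carries the built-in constraints of both rules and the equations between the
  -- resolved constraints and the head of v.
  have hflat' : ∀ (M : FirstOrder.Language.Theory.ModelType.{u, v, max u v} CT) (a : Var → M),
      (result s (r'.rename τ) H₁ H₂ G).cfg.Flat a ↔
        (∀ c ∈ v.bodyBuiltIn, c.Holds (a ∘ τ)) ∧
        ((chr (S₁ ++ S₂)).map (Atom.eval (a ∘ τ)) = v.head.map (Atom.eval (a ∘ τ))) ∧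
        (result s (r.rename τ) H₁ H₂ G).cfg.Flat a := by
    intro M a
    rw [flat_result ha.keep ha.remove, flat_result ha₁.keep ha₁.remove,
      ← forall_equations_holds_iff _ (comparable_append hS₁ hS₂)]
    simp only [Rule.rename, r', Multiset.mem_map, Multiset.mem_add, forall_exists_index, and_imp,
      forall_apply_eq_imp_iff₂, BuiltIn.holds_rename, or_imp, forall_and, Multiset.mem_coe]
    change _ ∧ ((chr (H₁ ++ H₂)).map (Atom.eval a) = (r.rename τ).head.map (Atom.eval a)) ∧ _ ↔
      _ ∧ _ ∧ _ ∧ ((chr (H₁ ++ H₂)).map (Atom.eval a) = (r.rename τ).head.map (Atom.eval a)) ∧ _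
    tauto
  -- If the constraints of r are inconsistent, so is the larger conjunction left by the unfolding,
  -- and v is never reached.
  rcases hsol.flat with ⟨h₁, h₂⟩ | ⟨hnf, hp₂, hflat⟩
  · exact ⟨s₂, hs₂, hg₂, Or.inl ⟨h₁, fun M a h' => h₂ M a ((hflat' M a).1 h').2.2⟩⟩
  -- the unfolding rule applies
  set n := s.cfg.counter with hn
  let f : IdAtom L Pr → IdAtom L Pr := fun k => (k.subst (varRenaming τ)).mapId fun i => i + n
  have hchrf : ∀ H : List (IdAtom L Pr),
      chr (H.map f) = (chr H).map (Atom.subst (varRenaming τ)) := by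
    intro H
    simp only [chr, List.map_map]
    rfl
  have hidf : ∀ H : List (IdAtom L Pr),
      (H.map f).map IdAtom.id = (H.map IdAtom.id).map fun i => i + n := by
    intro H
    simp only [List.map_map]
    rfl
  have hmapf : ∀ X : Multiset (IdAtom L Pr), (X.map (IdAtom.subst (varRenaming τ))).map
      (IdAtom.mapId fun i => i + n) = X.map f := fun X => Multiset.map_map _ _ X
  have hchrs₂ : s₂.cfg.chrs = ↑(S₁.map f) + ↑(S₂.map f) + (K.map f + ↑H₁ + G) := by
    rw [hsol.chrs]
    simp only [result, Rule.rename, hbody, ← hn]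
    rw [hmapf]
    simp only [Multiset.map_add, Multiset.map_coe]
    abel
  have hne : S₁ ++ S₂ ≠ [] := by
    intro h0
    have hcmp := (comparable_append hS₁ hS₂).length_eq
    rw [h0] at hcmp
    exact hvw'.head_ne (List.length_eq_zero_iff.1 hcmp.symm)
  have hHle : ∀ i ∈ (H₁ ++ H₂).map IdAtom.id, i ≤ n := by
    intro i hi
    obtain ⟨k, hk, rfl⟩ := List.mem_map.1 hi
    refine hg.wf.ids_le _ ⟨k, ?_, rfl⟩
    rw [ha.chrs]
    simp only [Multiset.mem_add, Multiset.mem_coe]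
    exact Or.inl (List.mem_append.1 hk)
  have hSr : ∀ k ∈ S₁ ++ S₂, k ∈ r.bodyChr := by
    intro k hk
    rw [hbody]
    simp only [Multiset.mem_add, Multiset.mem_coe]
    rcases List.mem_append.1 hk with hk | hk <;> tauto
  have ha₂ : Applicable CT s₂ (v.rename τ) (S₁.map f) (S₂.map f) (K.map f + ↑H₁ + G) := by
    refine ⟨hchrs₂, hnf, ?_, ?_, ?_, ?_, ?_⟩
    · rw [hsol.used, Set.disjoint_left]
      intro x hx hx'
      have hx₁ := (Rule.mem_fv_rename τ v x).1 hx
      rcases hx' with hx' | hx'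
      · refine hF _ (Or.inr hx₁) ?_
        simpa using hx'
      · exact Set.disjoint_left.1 happart hx₁ ((Rule.mem_fv_rename τ r x).1 hx')
    · rw [hchrf]
      exact (comparable_subst_iff _ _).2 hS₁
    · rw [hchrf]
      exact (comparable_subst_iff _ _).2 hS₂
    · intro M a hC
      have hC₁ := (hflat M a).2 ((Config.flat_of_pending hp₂ a).2 hC)
      obtain ⟨hrB, hrH, hsF⟩ := (flat_result ha₁.keep ha₁.remove a).1 hC₁
      obtain ⟨b, hb, hb₁, hb₂⟩ := ha.guard M a hsF.2
      -- From here on the guard of the unfolding holds under the assignment of the store itself.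
      obtain rfl : b = a := ha.eq_of_holds hCT hg M hb hrH hb₁
      rw [hr'guard] at hb₂
      have hm := hmatch M (b ∘ τ) (by
        intro c hc
        rw [← BuiltIn.holds_rename]
        rcases Multiset.mem_add.1 hc with hc | hc
        · exact hrB _ (Multiset.mem_map_of_mem _ hc)
        · exact hb₂ _ (Multiset.mem_add.2 (Or.inl (Multiset.mem_map_of_mem _ hc))))
      -- A constraint of the guard of v either was dropped, being entailed by the guard and body of
      -- r, or is part of the guard of the unfolding.
      have hD : ∀ c ∈ v.guard, (c.subst θ).Holds (b ∘ τ) := by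
        intro c hc
        by_cases hent : Entails CT (r.bodyBuiltIn + r.guard) {c.subst θ}
        · refine hent M (b ∘ τ) ?_ _ (Multiset.mem_singleton_self _)
          intro c hc
          rw [← BuiltIn.holds_rename]
          rcases Multiset.mem_add.1 hc with hc | hc
          · exact hrB _ (Multiset.mem_map_of_mem _ hc)
          · exact hb₂ _ (Multiset.mem_add.2 (Or.inl (Multiset.mem_map_of_mem _ hc)))
        · rw [← BuiltIn.holds_rename]
          refine hb₂ _ (Multiset.mem_add.2 (Or.inr (Multiset.mem_map_of_mem _
            (Multiset.mem_map_of_mem _ ?_))))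
          rw [hD'']
          exact Multiset.mem_filter.2 ⟨hc, hent⟩
      have hcomp : Comparable (chr (S₁ ++ S₂)) (v.head.map (Atom.subst θ)) :=
        (comparable_subst_right_iff θ).2 (comparable_append hS₁ hS₂)
      replace hm := (forall_equations_holds_iff (b ∘ τ) hcomp).1 fun c hc => hm c (by simpa using hc)
      -- The witness for v evaluates `θ`. It changes only head variables of v, and these do not
      -- occur in r, so the constraints to be matched keep their values.
      let d : Var → M := fun x => (θ x).realize (b ∘ τ)
      have hdτ : (d ∘ τ.symm) ∘ τ = d := by
        rw [Function.comp_assoc, Equiv.symm_comp_self, Function.comp_id]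
      have hdS : (chr (S₁ ++ S₂)).map (Atom.eval d) = (chr (S₁ ++ S₂)).map (Atom.eval (b ∘ τ)) := by
        refine map_eval_congr fun x hx => ?_
        obtain ⟨k, hk, hx⟩ := hx
        obtain ⟨k', hk', rfl⟩ := List.mem_map.1 hk
        have : x ∉ v.headFv := fun hx' => Set.disjoint_left.1 happart
          (Or.inl (Or.inl (Or.inl hx'))) (Or.inl (Or.inr ⟨k', hSr k' hk', hx⟩))
        simp [d, hθ x this]
      refine ⟨d ∘ τ.symm, ?_, ?_, ?_⟩
      · intro y hy
        rw [Rule.mem_headFv_rename] at hy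
        simp [d, hθ _ hy]
      · rw [← List.map_append, hchrf, map_eval_rename, Rule.head_rename, map_eval_rename, hdτ, hdS,
          hm, List.map_map]
        congr 1
        funext k
        exact k.eval_subst _ _
      · intro c hc
        obtain ⟨c', hc', rfl⟩ := Multiset.mem_map.1 hc
        rw [BuiltIn.holds_rename, hdτ, ← BuiltIn.holds_subst]
        exact hD c' hc'
    -- The token involves at least one shifted identifier, hence one above `n`. Tokens of `s` and
    -- the token just recorded for r stay at or below `n`, and the tokens of r are excluded by the
    -- unfolding condition.
    · obtain ⟨k, l, hkl⟩ := List.exists_cons_of_ne_nil hne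
      have hlt : ∀ i ∈ (S₁ ++ S₂).map IdAtom.id, 0 < i := by
        intro i hi
        obtain ⟨k, hk, rfl⟩ := List.mem_map.1 hi
        exact hrw.pos k (hSr k hk)
      have hknot : ¬ k.id + n ≤ n := by
        have := hlt k.id (by simp [hkl])
        omega
      rw [hsol.tokens, ← List.map_append, hidf]
      rintro ((ht | ⟨t, ht, e⟩) | ht)
      · exact hknot (hg.wf.tokens_le _ ⟨_, ht, by simp [hkl]⟩)
      · refine htoken ?_
        have : t = ⟨v.name, (S₁ ++ S₂).map IdAtom.id⟩ :=
          Token.mapId_injective (add_left_injective n) e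
        exact this ▸ ht
      · split_ifs at ht
        · simp only [Set.mem_singleton_iff, Token.mk.injEq] at ht
          refine hknot (hHle _ ?_)
          rw [← ht.2]
          simp [hkl]
        · exact ht
  subst hv
  -- The variant used in the unfolding need not belong to the program, so both renamings are merged
  -- into one renaming of `v₀`.
  rw [Rule.rename_rename] at ha₂
  obtain ⟨t, ht, hgt, hsol'⟩ := apply_solve hg₂ hp₂ hv₀ hvw ha₂
  rw [← Rule.rename_rename] at ha₂ hsol'
  set v := v₀.rename π₀
  have hcounter : s₂.cfg.counter = n + maxId r.bodyChr r.tokens := by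
    rw [hsol.counter]
    change n + maxId (r.bodyChr.map (IdAtom.subst (varRenaming τ))) r.tokens = _
    rw [maxId_map_subst]
  have hchrs : (result s (r'.rename τ) H₁ H₂ G).cfg.chrs =
      (result s₂ (v.rename τ) (S₁.map f) (S₂.map f) (K.map f + ↑H₁ + G)).cfg.chrs := by
    -- Unfolding shifts the identifiers of v past those of r, and applying the result shifts by `n`;
    -- running r and then v gives the same total shift.
    have hB : (v.bodyChr.map (IdAtom.mapId fun i => i + maxId r.bodyChr r.tokens)).map f =
        (v.rename τ).bodyChr.map (IdAtom.mapId fun i => i + s₂.cfg.counter) := by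
      simp only [Rule.rename, Multiset.map_map, hcounter]
      refine Multiset.map_congr rfl fun k _ => ?_
      simp only [Function.comp, IdAtom.mapId, IdAtom.subst, f, IdAtom.mk.injEq, true_and]
      omega
    change ((K + ↑S₁ + v.bodyChr.map (IdAtom.mapId fun i => i + maxId r.bodyChr r.tokens)).map
      (IdAtom.subst (varRenaming τ))).map (IdAtom.mapId fun i => i + n) + ↑H₁ + G =
      (v.rename τ).bodyChr.map (IdAtom.mapId fun i => i + s₂.cfg.counter) + ↑(S₁.map f) +
        (K.map f + ↑H₁ + G)
    rw [hmapf, Multiset.map_add, Multiset.map_add, Multiset.map_coe, hB]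
    abel
  refine ⟨t, hs₂.trans ht, hgt, Match.simulates (.of_eq V hchrs ?_ ?_) (hsol'.simulates V)⟩
  · intro M a
    have e : (∀ c ∈ (v.rename τ).bodyBuiltIn, c.Holds a) ↔ ∀ c ∈ v.bodyBuiltIn, c.Holds (a ∘ τ) := by
      change (∀ c ∈ v.bodyBuiltIn.map (BuiltIn.subst (varRenaming τ)), c.Holds a) ↔ _
      simp only [Multiset.mem_map, forall_exists_index, and_imp, forall_apply_eq_imp_iff₂,
        BuiltIn.holds_rename]
    rw [hflat', flat_result ha₂.keep ha₂.remove, ← hflat, ← List.map_append, hchrf,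
      map_eval_rename, Rule.head_rename τ v, map_eval_rename a τ, e]
  · rw [hchrs]
    have hS₂nil : S₂ = [] ↔ v.remove = [] := by
      have hl := hS₂.length_eq
      simp only [chr, List.length_map] at hl
      rw [← List.length_eq_zero_iff, ← List.length_eq_zero_iff, hl]
    have e₁ : (result s (r'.rename τ) H₁ H₂ G).cfg.tokens =
        s.cfg.tokens ∪ Token.mapId (fun i => i + n) '' (clean (K + ↑S₁ : Multiset (IdAtom L Pr)) r.tokens ∪
          Token.mapId (fun i => i + maxId r.bodyChr r.tokens) '' v.tokens ∪
            (if v.remove = [] then {⟨v.name, S₁.map IdAtom.id⟩} else ∅)) ∪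
        (if H₂ = [] then {⟨r.name, (H₁ ++ H₂).map IdAtom.id⟩} else ∅) := rfl
    have e₂ : (result s₂ (v.rename τ) (S₁.map f) (S₂.map f) (K.map f + ↑H₁ + G)).cfg.tokens =
        (s.cfg.tokens ∪ Token.mapId (fun i => i + n) '' r.tokens ∪
          (if H₂ = [] then {⟨r.name, (H₁ ++ H₂).map IdAtom.id⟩} else ∅)) ∪
        Token.mapId (fun i => i + s₂.cfg.counter) '' v.tokens ∪
        (if S₂.map f = [] then {⟨v.name, (S₁.map f ++ S₂.map f).map IdAtom.id⟩} else ∅) := by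
      change s₂.cfg.tokens ∪ _ ∪ _ = _
      rw [hsol.tokens]
      rfl
    have e₃ : Token.mapId (fun i => i + n) '' (if v.remove = [] then
          ({⟨v.name, S₁.map IdAtom.id⟩} : Set (Token Nm)) else ∅) =
        (if S₂.map f = [] then {⟨v.name, (S₁.map f ++ S₂.map f).map IdAtom.id⟩} else ∅) := by
      rw [← List.map_append, hidf]
      by_cases h : S₂ = []
      · rw [if_pos (hS₂nil.1 h), if_pos (List.map_eq_nil_iff.2 h), Set.image_singleton, h,
          List.append_nil]
        rfl
      · rw [if_neg (mt hS₂nil.2 h), if_neg (mt List.map_eq_nil_iff.1 h), Set.image_empty]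
    have e₄ : Token.mapId (fun i => i + n) ''
          (Token.mapId (fun i => i + maxId r.bodyChr r.tokens) '' v.tokens) =
        Token.mapId (fun i => i + s₂.cfg.counter) '' v.tokens := by
      rw [Set.image_image]
      refine Set.image_congr fun t _ => ?_
      rw [Token.mapId_mapId]
      refine t.mapId_congr fun i _ => ?_
      simp only [Function.comp, hcounter]
      omega
    rw [e₁, e₂, Set.image_union, Set.image_union, e₃, e₄]
    -- The stores differ only in tokens of r that refer to constraints consumed by v: unfolding has
    -- removed them already, and cleaning removes them here.
    ext t
    constructor
    · rintro ⟨ht, hti⟩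
      refine ⟨?_, hti⟩
      rcases ht with (ht | (⟨t, ht, rfl⟩ | ht) | ht) | ht
      · exact Or.inl (Or.inl (Or.inl (Or.inl ht)))
      · exact Or.inl (Or.inl (Or.inl (Or.inr ⟨t, ht.1, rfl⟩)))
      · exact Or.inl (Or.inr ht)
      · exact Or.inr ht
      · exact Or.inl (Or.inl (Or.inr ht))
    · rintro ⟨ht, hti⟩
      refine ⟨?_, hti⟩
      rcases ht with (((ht | ⟨t, ht, rfl⟩) | ht) | ht) | ht
      · exact Or.inl (Or.inl ht)
      · refine Or.inl (Or.inr (Or.inl (Or.inl ⟨t, ⟨ht, fun i hi => ?_⟩, rfl⟩)))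
        have hir := hrw.tokens_sub ⟨t, ht, hi⟩
        have hi₀ : 0 < i := by
          obtain ⟨k, hk, rfl⟩ := hir
          exact hrw.pos k hk
        have hi₁ := le_maxId hrw.tokens_sub hir
        have hi₂ := hti (i + n) (List.mem_map.2 ⟨i, hi, rfl⟩)
        have hf : ∀ X : Multiset (IdAtom L Pr), i + n ∈ idSet (X.map f) → i ∈ idSet X := by
          intro X hX
          obtain ⟨k, hk, e⟩ := (mem_idSet_map _ _ _).1 hX
          exact ⟨k, hk, Nat.add_right_cancel e⟩
        have hold : ∀ X : Multiset (IdAtom L Pr), X ≤ s.cfg.chrs → i + n ∉ idSet X := by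
          rintro X hX ⟨k, hk, e⟩
          have := hg.wf.ids_le _ ⟨k, Multiset.mem_of_le hX hk, e⟩
          omega
        simp only [result, idSet_add, ← Multiset.map_coe] at hi₂
        rw [idSet_add]
        -- A shifted identifier of r lies strictly above the old ones and at or below the counter
        -- reached after r, so among the live constraints it can only belong to `S₁` or `K`.
        rcases hi₂ with (hi₂ | hi₂) | (hi₂ | hi₂) | hi₂
        · obtain ⟨j, hj, e⟩ := (mem_idSet_mapId _ _ _).1 hi₂
          obtain ⟨k, hk, rfl⟩ := (mem_idSet_map _ _ _).1 hj
          have := hvw'.pos k hk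
          rw [hcounter] at e
          change k.id + _ = _ at e
          omega
        · exact Or.inr (hf _ hi₂)
        · exact Or.inl (hf _ hi₂)
        · refine (hold _ ?_ hi₂).elim
          rw [ha.chrs, add_assoc]
          exact Multiset.le_add_right _ _
        · refine (hold _ ?_ hi₂).elim
          rw [ha.chrs]
          exact Multiset.le_add_left _ _
      · exact Or.inr ht
      · exact Or.inl (Or.inr (Or.inl (Or.inr ht)))
      · exact Or.inl (Or.inr (Or.inr ht))

/-- The identifiers taken from v are positive before being shifted by the greatest identifier of r,
so they cannot clash with those kept from r. -/
theorem IsUnfolding.wellFormed {CT : L.Theory} {r v₀ r' : Rule L Pr Nm} (hrw : r.WellFormed)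
    (hvw : v₀.WellFormed) (h : IsUnfolding CT r v₀ r') : r'.WellFormed := by
  classical
  obtain ⟨v, π₀, K, S₁, S₂, θ, D'', B₁, T₁, m₁, hv, -, hbody, -, hS₂, -, -, -, -, -, hinst⟩ := h
  have hvw' : v.WellFormed := hv ▸ hvw.rename π₀
  simp only [inst, Prod.mk.injEq] at hinst
  obtain ⟨rfl, rfl, rfl⟩ := hinst
  have hKS : ∀ k ∈ K + ↑S₁, k ∈ r.bodyChr := fun k hk => by
    rw [hbody]
    exact Multiset.mem_add.2 (Or.inl hk)
  refine ⟨hrw.head_ne, ?_, ?_, ?_⟩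
  · have h₁ := hrw.nodup
    rw [hbody, Multiset.map_add, Multiset.nodup_add] at h₁
    simp only
    rw [Multiset.map_add, Multiset.nodup_add]
    refine ⟨h₁.1, ?_, ?_⟩
    · have := hvw'.nodup.map (add_left_injective (maxId r.bodyChr r.tokens))
      rw [Multiset.map_map] at this ⊢
      exact this
    · rw [Multiset.disjoint_left]
      intro i hi hi'
      obtain ⟨k, hk, rfl⟩ := Multiset.mem_map.1 hi
      obtain ⟨k', hk', e⟩ := Multiset.mem_map.1 hi'
      obtain ⟨k', hk'', rfl⟩ := Multiset.mem_map.1 hk'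
      have h₂ := le_maxId hrw.tokens_sub ⟨k, hKS k hk, rfl⟩
      have h₃ := hvw'.pos k' hk''
      change k'.id + _ = _ at e
      omega
  · intro k hk
    rcases Multiset.mem_add.1 hk with hk | hk
    · exact hrw.pos k (hKS k hk)
    · obtain ⟨k', hk', rfl⟩ := Multiset.mem_map.1 hk
      exact Nat.add_pos_left (hvw'.pos k' hk') _
  · rintro i ⟨t, (ht | ⟨t, ht, rfl⟩) | ht, hi⟩
    · rw [idSet_add]
      exact Or.inl (ht.2 i hi)
    · obtain ⟨j, hj, rfl⟩ := List.mem_map.1 hi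
      rw [idSet_add]
      exact Or.inr ((mem_idSet_mapId _ _ _).2 ⟨j, hvw'.tokens_sub ⟨t, ht, hj⟩, rfl⟩)
    -- The token recorded for v mentions only `S₁`, and these constraints remain in the body.
    · split_ifs at ht
      · obtain rfl := ht
        obtain ⟨k, hk, rfl⟩ := List.mem_map.1 hi
        exact ⟨k, by simp [hk], rfl⟩
      · exact ht.elim

theorem IsUnfolding.same_head {CT : L.Theory} {r v₀ r' : Rule L Pr Nm}
    (h : IsUnfolding CT r v₀ r') : r'.name = r.name ∧ r'.keep = r.keep ∧ r'.remove = r.remove := by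
  cases h
  exact ⟨rfl, rfl, rfl⟩

/-- Applicability does not look at the body except through freshness, which is asked for separately
because the new body may have further variables. For the guard, entailment in one direction is
enough. -/
theorem Applicable.of_equivalent_guard {CT : L.Theory} {s : Stage L Pr Nm} {r r' : Rule L Pr Nm}
    {τ : Equiv.Perm Var} {H₁ H₂ : List (IdAtom L Pr)} {G : Multiset (IdAtom L Pr)}
    (ha : Applicable CT s (r.rename τ) H₁ H₂ G) (hname : r'.name = r.name) (hkeep : r'.keep = r.keep)
    (hremove : r'.remove = r.remove) (hguard : Entails CT r.guard r'.guard)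
    (hτ : ∀ x ∈ r'.fv, τ x ∉ s.used) : Applicable CT s (r'.rename τ) H₁ H₂ G := by
  have hhead : (r'.rename τ).head = (r.rename τ).head := by
    simp only [Rule.head, Rule.rename, hkeep, hremove]
  refine ⟨ha.chrs, ha.nonfailed, ?_, ?_, ?_, ?_, ?_⟩
  · rw [Set.disjoint_left]
    intro x hx hx'
    refine hτ _ ((Rule.mem_fv_rename τ r' x).1 hx) ?_
    simpa using hx'
  · simpa only [Rule.rename, hkeep] using ha.keep
  · simpa only [Rule.rename, hremove] using ha.remove
  · intro M a hC
    obtain ⟨b, hb, hb₁, hb₂⟩ := ha.guard M a hC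
    refine ⟨b, ?_, by rw [hhead, hb₁], ?_⟩
    · simpa only [Rule.headFv, hhead] using hb
    · intro c hc
      obtain ⟨c', hc', rfl⟩ := Multiset.mem_map.1 hc
      rw [BuiltIn.holds_rename]
      refine hguard M (b ∘ τ) (fun d hd => ?_) c' hc'
      rw [← BuiltIn.holds_rename]
      exact hb₂ _ (Multiset.mem_map_of_mem _ hd)
  · simpa only [Rule.rename, hname] using ha.token

/-! ### Simulation of the transformed program -/

section Simulation

variable {CT : L.Theory} {P : Set (Rule L Pr Nm)} {r : Rule L Pr Nm} {V : Set Var}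

theorem Unf.wellFormed (hP : IsAnnotatedProgram P) (hr : r ∈ P) :
    IsAnnotatedProgram ((P \ {r}) ∪ Unf CT P r) := by
  rintro r' (hr' | ⟨v, hv, hr'⟩)
  · exact hP r' hr'.1
  · exact hr'.wellFormed (hP r hr) (hP v hv)

theorem Good.apply {s t : Stage L Pr Nm} (hP : IsAnnotatedProgram P) (h : Good V s)
    (hst : ApplyStep CT P s t) : Good V t := by
  obtain ⟨r₀, hr₀, τ, H₁, H₂, G, ha, rfl⟩ := applyStep_iff.1 hst
  exact h.result ((hP r₀ hr₀).rename τ) ha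

theorem Good.normalStep {s t : Stage L Pr Nm} (hP : IsAnnotatedProgram P) (h : Good V s)
    (hst : NormalStep CT P s t) : Good V t :=
  hst.elim h.solve fun h' => h.apply hP h'.2

/-- Solve' only moves a conjunct from the pending constraints into the store, so `Flat` is unchanged
and `s` need not move. -/
theorem Simulates.solve {s' s'' s : Stage L Pr Nm} (h : Simulates CT V s' s)
    (hst : SolveStep CT s' s'') : Simulates CT V s'' s := by
  obtain ⟨U, S, c, G, C, C', T, n, -, hC⟩ := hst
  refine Match.simulates (s' := ⟨U, ⟨S, c ::ₘ G, C, T, n⟩⟩) (.of_eq V rfl (fun M a => ?_) rfl) h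
  have e : (c.and C).Holds a ↔ C'.Holds a :=
    ⟨fun h => hC.1 M a (by simpa using h) _ (Multiset.mem_singleton_self _),
      fun h => hC.2 M a (by simpa using h) _ (Multiset.mem_singleton_self _)⟩
  rw [BuiltIn.holds_and] at e
  simp only [Config.Flat, Multiset.mem_cons, forall_eq_or_imp, ← e]
  tauto

/-- With nothing pending, a solution of the nonfailed store is a solution of `Flat`, which rules out
the failure branch. -/
theorem Simulates.matches {s' s : Stage L Pr Nm} (h : Simulates CT V s' s)
    (hnf : ¬ s'.cfg.Failed CT) (hp' : s'.cfg.pending = 0) :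
    s.cfg.pending = 0 ∧ ∃ π ρ, Match CT V π ρ s'.cfg s.cfg := by
  rcases h with ⟨-, h⟩ | h
  · refine (hnf (Config.failed_iff.2 fun M a ha => h M a ?_)).elim
    exact (Config.flat_of_pending hp' a).2 ha
  · exact h

/-- Normality makes this possible: at an Apply' step nothing is pending on either side, so agreement
of `Flat` is agreement of the stores, which is what guards are checked against. -/
theorem Simulates.apply (hCT : ClarkEquality CT) (hP : IsAnnotatedProgram P) (hr : r ∈ P)
    {s' s'' s : Stage L Pr Nm} (h : Simulates CT V s' s) (hg' : Good V s') (hg : Good V s)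
    (hbf : s'.cfg.BuiltInFree CT) (hst : ApplyStep CT ((P \ {r}) ∪ Unf CT P r) s' s'') :
    ∃ t, Relation.TransGen (NormalStep CT P) s t ∧ Good V t ∧ Simulates CT V s'' t := by
  obtain ⟨r₀, hr₀, τ, H₁, H₂, G, ha, rfl⟩ := applyStep_iff.1 hst
  have hp' := hbf.resolve_left ha.nonfailed
  obtain ⟨hp, π, ρ, hm⟩ := h.matches ha.nonfailed hp'
  have hw := Unf.wellFormed (CT := CT) hP hr r₀ hr₀
  rcases hr₀ with hr₀ | ⟨v, hv, hr₀⟩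
  · obtain ⟨τ₂, H₁', H₂', G', -, ha', π', ρ', hm'⟩ :=
      exists_transfer hg' hg hm hp' hp hw ha Set.finite_empty
    obtain ⟨t, ht, hgt, hsol⟩ := apply_solve hg hp hr₀.1 hw ha'
    exact ⟨t, ht, hgt, hm'.simulates (hsol.simulates V)⟩
  · obtain ⟨F, hF, hsim⟩ := hr₀.exists_simulation hCT hr hv (hP r hr) (hP v hv)
    obtain ⟨τ₂, H₁', H₂', G', hfresh, ha', π', ρ', hm'⟩ := exists_transfer hg' hg hm hp' hp hw ha hF
    obtain ⟨t, ht, hgt, hs⟩ := hsim V s τ₂ H₁' H₂' G' hg hp ha' hfresh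
    exact ⟨t, ht, hgt, hm'.simulates hs⟩

/-- Lexicographic descent, first along derivations of P, then in the number of pending constraints:
Apply' moves `s` by at least one step, and Solve' keeps `s` but removes a pending constraint. -/
theorem Simulates.acc (hCT : ClarkEquality CT) (hP : IsAnnotatedProgram P) (hr : r ∈ P)
    {s : Stage L Pr Nm} (hs : Acc (fun t s => Relation.TransGen (NormalStep CT P) s t) s)
    (hg : Good V s) {s' : Stage L Pr Nm} (hg' : Good V s') (h : Simulates CT V s' s) :
    Acc (fun t s => NormalStep CT ((P \ {r}) ∪ Unf CT P r) s t) s' := by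
  induction hs generalizing s' with
  | intro s _ ih =>
    obtain ⟨n, hn⟩ : ∃ n, Multiset.card s'.cfg.pending = n := ⟨_, rfl⟩
    induction n generalizing s' with
    | zero =>
      refine ⟨_, fun t hst => ?_⟩
      rcases hst with hst | ⟨hbf, hst⟩
      · obtain ⟨U, S, c, G, C, C', T, n, -, hC⟩ := hst
        simp at hn
      · obtain ⟨t', ht', hgt', hsim⟩ := h.apply hCT hP hr hg' hg hbf hst
        exact ih t' ht' hgt' (hg'.apply (Unf.wellFormed hP hr) hst) hsim
    | succ n ihn =>
      refine ⟨_, fun t hst => ?_⟩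
      rcases hst with hst | ⟨hbf, hst⟩
      · refine ihn (hg'.solve hst) (h.solve hst) ?_
        obtain ⟨U, S, c, G, C, C', T, n, -, hC⟩ := hst
        simpa using hn
      · obtain ⟨t', ht', hgt', hsim⟩ := h.apply hCT hP hr hg' hg hbf hst
        exact ih t' ht' hgt' (hg'.apply (Unf.wellFormed hP hr) hst) hsim

/-- The transitive closure is needed because one step of the transformed program may cost several
steps of P. -/
theorem acc_of_normalTerminating (hterm : NormalTerminating CT P) {σ : Config L Pr Nm}
    (hσ : σ.WellFormed) {s : Stage L Pr Nm}
    (hs : Relation.ReflTransGen (NormalStep CT P) (Stage.start σ) s) :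
    Acc (fun t s => Relation.TransGen (NormalStep CT P) s t) s := by
  have h₀ : Acc (fun t s => NormalStep CT P s t) (Stage.start σ) := by
    rw [acc_iff_isEmpty_descending_chain]
    exact ⟨fun f => hterm σ hσ ⟨f.1, f.2⟩⟩
  have h₁ : Acc (fun t s => NormalStep CT P s t) s := by
    induction hs with
    | refl => exact h₀
    | tail _ hst ih => exact ih.inv hst
  have h₂ := h₁.transGen
  refine Subrelation.accessible (fun {a b} hab => ?_) h₂
  exact Relation.transGen_swap.2 hab

theorem exists_stuck {A : Type*} {R : A → A → Prop} {s : A} (h : Acc (fun t s => R s t) s) :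
    ∃ t, Relation.ReflTransGen R s t ∧ ∀ u, ¬ R t u := by
  induction h with
  | intro s _ ih =>
    by_cases hs : ∃ u, R s u
    · obtain ⟨u, hu⟩ := hs
      obtain ⟨t, ht, h⟩ := ih u hu
      exact ⟨t, .head hu ht, h⟩
    · exact ⟨s, .refl, fun u hu => hs ⟨u, hu⟩⟩

theorem exists_simulates_start (CT : L.Theory) (P : Set (Rule L Pr Nm)) {σ : Config L Pr Nm}
    (hσ : σ.WellFormed) :
    ∃ s, Relation.ReflTransGen (NormalStep CT P) (Stage.start σ) s ∧ Good σ.fv s ∧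
      Simulates CT σ.fv (Stage.start σ) s := by
  have hg := good_start hσ
  obtain ⟨s, hs, h⟩ := exists_solved CT _ hg.fv
  exact ⟨s, Relation.ReflTransGen.mono (fun _ _ => Or.inl) _ _ hs, hg.solves hs,
    h.simulates σ.fv⟩

theorem exists_simulates (hCT : ClarkEquality CT) (hP : IsAnnotatedProgram P) (hr : r ∈ P)
    {σ : Config L Pr Nm} (hσ : σ.WellFormed) {s' : Stage L Pr Nm}
    (hs' : Relation.ReflTransGen (NormalStep CT ((P \ {r}) ∪ Unf CT P r)) (Stage.start σ) s') :
    Good σ.fv s' ∧ ∃ s, Relation.ReflTransGen (NormalStep CT P) (Stage.start σ) s ∧ Good σ.fv s ∧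
      Simulates CT σ.fv s' s := by
  induction hs' with
  | refl => exact ⟨good_start hσ, exists_simulates_start CT P hσ⟩
  | tail _ hst ih =>
    obtain ⟨hg', s, hs, hg, h⟩ := ih
    refine ⟨hg'.normalStep (Unf.wellFormed hP hr) hst, ?_⟩
    rcases hst with hst | ⟨hbf, hst⟩
    · exact ⟨s, hs, hg, h.solve hst⟩
    · obtain ⟨t, ht, hgt, h'⟩ := h.apply hCT hP hr hg' hg hbf hst
      exact ⟨t, hs.trans ht.to_reflTransGen, hgt, h'⟩

/-! ### Final configurations -/

theorem not_step_of_failed {s u : Stage L Pr Nm} (h : s.cfg.Failed CT) : ¬ Step CT P s u := by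
  rintro (hst | hst)
  · obtain ⟨U, S, c, G, C, C', T, n, hnf, hC⟩ := hst
    exact hnf h
  · obtain ⟨r₀, hr₀, τ, H₁, H₂, G, ha, rfl⟩ := applyStep_iff.1 hst
    exact ha.nonfailed h

/-- Both configurations are failed, or they are built-in free and match. -/
def SameOutcome (CT : L.Theory) (V : Set Var) (σ' σ : Config L Pr Nm) : Prop :=
  (σ'.Failed CT ∧ σ.Failed CT) ∨
    (σ'.pending = 0 ∧ σ.pending = 0 ∧ ∃ π ρ, Match CT V π ρ σ' σ)

theorem SameOutcome.failed_iff {σ' σ : Config L Pr Nm} (h : SameOutcome CT V σ' σ) :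
    σ'.Failed CT ↔ σ.Failed CT := by
  rcases h with h | ⟨hp', hp, π, ρ, hm⟩
  · simp [h.1, h.2]
  · exact hm.failed_iff hp' hp

theorem EquivUpTo.failed_iff {σ' σ : Config L Pr Nm} (h : EquivUpTo CT V σ' σ) :
    σ'.Failed CT ↔ σ.Failed CT := by
  rcases h with h | ⟨π, ρ, -, -, -, h, -⟩
  · simp [h.1, h.2]
  · simp only [Config.failed_iff]
    constructor
    · intro hf M a ha
      refine hf M (a ∘ π) ((BuiltIn.holds_rename _ _ _).1 ?_)
      exact h.2 M a (by simpa using ha) _ (Multiset.mem_singleton_self _)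
    · intro hf M a ha
      refine hf M (a ∘ π.symm) (h.1 M _ ?_ _ (Multiset.mem_singleton_self _))
      intro c hc
      rw [Multiset.mem_singleton.1 hc, BuiltIn.holds_rename, Function.comp_assoc,
        Equiv.symm_comp_self, Function.comp_id]
      exact ha

theorem Match.equivUpTo {π : Equiv.Perm Var} {ρ : Equiv.Perm ℕ} {σ' σ : Config L Pr Nm}
    (h : Match CT V π ρ σ' σ) (hp' : σ'.pending = 0) (hp : σ.pending = 0) :
    EquivUpTo CT V σ' σ := by
  have key : ∀ (M : FirstOrder.Language.Theory.ModelType.{u, v, max u v} CT) (a : Var → M),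
      (σ'.store.subst (varRenaming π)).Holds a ↔ σ.store.Holds a := by
    intro M a
    rw [BuiltIn.holds_rename, ← Config.flat_of_pending hp', ← Config.flat_of_pending hp]
    exact h.flat M a
  refine Or.inr ⟨π, ρ, h.fix, h.chrs, ?_, ⟨?_, ?_⟩, h.tokens⟩
  · rw [hp', hp]
    exact .zero
  · intro M a ha d hd
    rw [Multiset.mem_singleton.1 hd]
    exact (key M a).1 (ha _ (Multiset.mem_singleton_self _))
  · intro M a ha d hd
    rw [Multiset.mem_singleton.1 hd]
    exact (key M a).2 (ha _ (Multiset.mem_singleton_self _))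

/-- With nothing pending, `Flat` is just the store. Failure is excluded because two failed
configurations are equivalent without any renaming between them. -/
theorem EquivUpTo.matches {σ' σ : Config L Pr Nm} (h : EquivUpTo CT V σ' σ)
    (hnf : ¬ σ.Failed CT) (hp' : σ'.pending = 0) (hp : σ.pending = 0) :
    ∃ π ρ, Match CT V π ρ σ' σ := by
  obtain ⟨π, ρ, h₁, h₂, -, h₃, h₄⟩ := h.resolve_left fun h => hnf h.2
  refine ⟨π, ρ, h₁, h₂, fun M a => ?_, h₄⟩
  rw [Config.flat_of_pending hp', Config.flat_of_pending hp, ← BuiltIn.holds_rename]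
  constructor
  · intro ha
    exact h₃.1 M a (by simpa using ha) _ (Multiset.mem_singleton_self _)
  · intro ha
    exact h₃.2 M a (by simpa using ha) _ (Multiset.mem_singleton_self _)

theorem SameOutcome.equivUpTo {σ₁ σ₁' σ₂ σ₂' : Config L Pr Nm} (h₁ : SameOutcome CT V σ₁' σ₁)
    (h₂ : SameOutcome CT V σ₂' σ₂) (h : EquivUpTo CT V σ₁ σ₂) : EquivUpTo CT V σ₁' σ₂' := by
  by_cases hf : σ₁.Failed CT
  · exact Or.inl ⟨h₁.failed_iff.2 hf, h₂.failed_iff.2 (h.failed_iff.1 hf)⟩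
  · have hf₂ : ¬ σ₂.Failed CT := fun h' => hf (h.failed_iff.2 h')
    obtain ⟨hp₁', hp₁, π₁, ρ₁, hm₁⟩ := h₁.resolve_left fun h => hf h.2
    obtain ⟨hp₂', hp₂, π₂, ρ₂, hm₂⟩ := h₂.resolve_left fun h => hf₂ h.2
    obtain ⟨π, ρ, hm⟩ := h.matches hf₂ hp₁ hp₂
    exact ((hm₁.trans hm).trans hm₂.symm).equivUpTo hp₁' hp₂'

/-- A rule of P applicable at `s` would transfer to `s'` along the inverse match. The only such rule
possibly missing from the new program is r, and there the unfolding with an equivalent guard applies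
instead. -/
theorem Simulates.of_stuck (hP : IsAnnotatedProgram P) (hr : WeaklySafelyReplaceable CT P r)
    {s' s : Stage L Pr Nm} (h : Simulates CT V s' s) (hg' : Good V s') (hg : Good V s)
    (hstuck : ∀ u, ¬ NormalStep CT ((P \ {r}) ∪ Unf CT P r) s' u) :
    (∀ u, ¬ Step CT P s u) ∧ SameOutcome CT V s'.cfg s.cfg := by
  by_cases hf : s'.cfg.Failed CT
  · have hfs : s.cfg.Failed CT := by
      rcases h with h | ⟨hp, π, ρ, hm⟩
      · exact h.1
      · refine Config.failed_iff.2 fun M a ha => hm.symm.flat_unsat (fun M a ha => ?_) M a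
          ((Config.flat_of_pending hp a).2 ha)
        exact Config.failed_iff.1 hf M a ha.2
    exact ⟨fun u => not_step_of_failed hfs, Or.inl ⟨hf, hfs⟩⟩
  -- A nonfailed stage with a pending constraint could still perform Solve'.
  have hp' : s'.cfg.pending = 0 := by
    obtain ⟨U, S, Q, C, T, n⟩ := s'
    induction Q using Multiset.induction_on with
    | empty => rfl
    | cons c Q _ =>
      exact (hstuck _ (Or.inl (SolveStep.mk U S c Q C (c.and C) T n hf
        ⟨fun _ _ h => h, fun _ _ h => h⟩))).elim
  obtain ⟨hp, π, ρ, hm⟩ := h.matches hf hp'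
  refine ⟨?_, Or.inr ⟨hp', hp, π, ρ, hm⟩⟩
  rintro u (hst | hst)
  · obtain ⟨U, S, c, G, C, C', T, n, -, -⟩ := hst
    exact Multiset.cons_ne_zero hp
  · obtain ⟨r₀, hr₀, τ, H₁, H₂, G, ha, rfl⟩ := applyStep_iff.1 hst
    obtain ⟨hrP, r', ⟨v, hv, hr'⟩, hguard⟩ := hr
    obtain ⟨τ₂, H₁', H₂', G', hfresh, ha', -⟩ :=
      exists_transfer hg hg' hm.symm hp hp' (hP r₀ hr₀) ha r'.finite_fv
    -- The variables of the unfolding `r'` were made fresh in the transfer, so it can stand in for r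
    -- under the same renaming.
    by_cases e : r₀ = r
    · subst e
      obtain ⟨h₁, h₂, h₃⟩ := hr'.same_head
      have ha'' := ha'.of_equivalent_guard h₁ h₂ h₃ hguard.1 hfresh
      exact hstuck _ (Or.inr ⟨Or.inr hp', applyStep_iff.2
        ⟨r', Or.inr ⟨v, hv, hr'⟩, τ₂, H₁', H₂', G', ha'', rfl⟩⟩)
    · exact hstuck _ (Or.inr ⟨Or.inr hp', applyStep_iff.2
        ⟨r₀, Or.inl ⟨hr₀, e⟩, τ₂, H₁', H₂', G', ha', rfl⟩⟩)

/-! ### Preservation of normal termination and normal confluence. -/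

theorem NormalTerminating.unf (hCT : ClarkEquality CT) (hP : IsAnnotatedProgram P) (hr : r ∈ P)
    (hterm : NormalTerminating CT P) : NormalTerminating CT ((P \ {r}) ∪ Unf CT P r) := by
  rintro σ hσ ⟨f, hf⟩
  obtain ⟨s, hs, hg, h⟩ := exists_simulates_start CT P hσ
  have hacc := h.acc hCT hP hr (acc_of_normalTerminating hterm hσ hs) hg (good_start hσ)
  rw [acc_iff_isEmpty_descending_chain] at hacc
  exact hacc.false ⟨f, hf⟩

theorem NormalConfluent.unf (hCT : ClarkEquality CT) (hP : IsAnnotatedProgram P)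
    (hr : WeaklySafelyReplaceable CT P r) (hterm : NormalTerminating CT P)
    (hconf : NormalConfluent CT P) : NormalConfluent CT ((P \ {r}) ∪ Unf CT P r) := by
  have hfinal : ∀ (σ : Config L Pr Nm) (s' : Stage L Pr Nm), σ.WellFormed →
      Relation.ReflTransGen (NormalStep CT ((P \ {r}) ∪ Unf CT P r)) (Stage.start σ) s' →
      ∃ f' f, Relation.ReflTransGen (Step CT ((P \ {r}) ∪ Unf CT P r)) s' f' ∧
        Relation.ReflTransGen (NormalStep CT P) (Stage.start σ) f ∧
        (∀ u, ¬ Step CT P f u) ∧ SameOutcome CT σ.fv f'.cfg f.cfg := by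
    intro σ s' hσ hs'
    obtain ⟨hg', s, hs, hg, h⟩ := exists_simulates hCT hP hr.1 hσ hs'
    obtain ⟨f', hf', hstuck⟩ := exists_stuck
      (h.acc hCT hP hr.1 (acc_of_normalTerminating hterm hσ hs) hg hg')
    -- The extended derivation is simulated from its start, so `f` is reached by a normal derivation
    -- of P from `σ`, as confluence of P requires.
    obtain ⟨hgf', f, hf, hgf, hsim⟩ := exists_simulates hCT hP hr.1 hσ (hs'.trans hf')
    obtain ⟨h₁, h₂⟩ := hsim.of_stuck hP hr hgf' hgf hstuck
    exact ⟨f', f, Relation.ReflTransGen.mono (fun _ _ h => h.imp id And.right) _ _ hf', hf, h₁, h₂⟩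
  intro σ s₁ s₂ hσ hs₁ hs₂
  obtain ⟨f₁', f₁, hf₁', hf₁, hst₁, ho₁⟩ := hfinal σ s₁ hσ hs₁
  obtain ⟨f₂', f₂, hf₂', hf₂, hst₂, ho₂⟩ := hfinal σ s₂ hσ hs₂
  obtain ⟨g₁, g₂, hg₁, hg₂, he⟩ := hconf σ f₁ f₂ hσ hf₁ hf₂
  -- Continuations in the definition of confluence need not be normal; since the stages are stuck
  -- for all steps, only the trivial continuation remains.
  have e : ∀ {f g : Stage L Pr Nm}, (∀ u, ¬ Step CT P f u) →
      Relation.ReflTransGen (Step CT P) f g → g = f := by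
    intro f g hf hfg
    rcases hfg.cases_head with h | ⟨u, hu, -⟩
    · exact h.symm
    · exact (hf u hu).elim
  rw [e hst₁ hg₁, e hst₂ hg₂] at he
  exact ⟨f₁', f₂', hf₁', hf₂', ho₁.equivUpTo ho₂ he⟩

end Simulation

end CHR

theorem mainTheorem9 {L : FirstOrder.Language.{u, v}} {Pr : Type w} {Nm : Type z}
    (CT : L.Theory) (hCT : CHR.ClarkEquality CT)
    (P : Set (CHR.Rule L Pr Nm)) (hP : CHR.IsAnnotatedProgram P)
    (r : CHR.Rule L Pr Nm) (hr : CHR.WeaklySafelyReplaceable CT P r)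
    (hterm : CHR.NormalTerminating CT P) (hconf : CHR.NormalConfluent CT P) :
    CHR.NormalTerminating CT ((P \ {r}) ∪ CHR.Unf CT P r) ∧
      CHR.NormalConfluent CT ((P \ {r}) ∪ CHR.Unf CT P r) := by
  exact ⟨hterm.unf hCT hP hr.1, hconf.unf hCT hP hr hterm⟩
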